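/- For $n\ge 1$ let $\sigma=(x_1,\dots,x_n,x'_1,\dots,x'_n)$ and $\pi=(y_1,\dots,y_n,y'_1,\dots,y'_n)$ be two permutations of $\{1,\dots,2n\}$, chosen independently and uniformly at random. Let $L_n$ be the random 2-component oriented grid link whose first component is the closed path $(x_1,y_1)\to(x_1,y_2)\to(x_2,y_2)\to(x_2,y_3)\to\dots\to(x_n,y_n)\to(x_n,y_1)\to(x_1,y_1)$ and whose second component is the path obtained in the same way from the $x'_l,y'_l$, where vertical edges always pass over horizontal edges. Let $lk(L_n)$ be its linking number, i.e. the sum of the signs of the crossings at which the first component passes under the second. Then for every integer $u\ge 0$ the limit $\mu_u=\lim_{n\to\infty}E\big[(lk(L_n)/n)^u\big]$ exists in $\mathbb{R}$, with $\mu_2=1/36$. There is a probability distribution on $\mathbb{R}$ that has finite moments of all orders, the $u$-th one being $\mu_u$ for every $u$, and it is the unique probability distribution with these moments. The normalized linking number $lk(L_n)/n$ converges weakly to this distribution as $n\to\infty$: if $F$ is its distribution function, then $P(lk(L_n)/n\le y)\to F(y)$ for every continuity point $y$ of $F$. -/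

import Mathlib

open MeasureTheory ProbabilityTheory Filter Topology

noncomputable section

namespace GridModel

/-- A 2-component oriented grid link diagram of order `2n`, given by the pair `(σ, π)` of
permutations in `S_{2n}` that determines it. -/
abbrev GridLink (n : ℕ) : Type := Equiv.Perm (Fin (2 * n)) × Equiv.Perm (Fin (2 * n))

/-- The position in `{1, …, 2n}` of the `k`-th entry that belongs to component `c`: the first
component `c = 0` uses the positions `1, …, n`, the second one `c = 1` uses `n + 1, …, 2n`
(everything is shifted by one, since `Fin` starts at `0`). -/
def position {n : ℕ} (c : Fin 2) (k : Fin n) : Fin (2 * n) := finProdFinEquiv (c, k)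

/-- The coordinate `x_k` (component `0`), respectively `x'_k` (component `1`), in `{1, …, 2n}`. -/
def xCoord {n : ℕ} (L : GridLink n) (c : Fin 2) (k : Fin n) : ℝ :=
  ((L.1 (position c k) : ℕ) : ℝ) + 1

/-- The coordinate `y_k` (component `0`), respectively `y'_k` (component `1`), in `{1, …, 2n}`. -/
def yCoord {n : ℕ} (L : GridLink n) (c : Fin 2) (k : Fin n) : ℝ :=
  ((L.2 (position c k) : ℕ) : ℝ) + 1

/-- An oriented straight edge of a plane diagram. -/
structure OrientedEdge where
  /-- the initial vertex -/
  src : ℝ × ℝ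
  /-- the terminal vertex -/
  tgt : ℝ × ℝ

/-- The `k`-th vertical edge `(x_k, y_k) → (x_k, y_{k+1})` of component `c`, the index `k + 1`
being taken modulo `n`. -/
def verticalEdge {n : ℕ} (L : GridLink n) (c : Fin 2) (k : Fin n) : OrientedEdge where
  src := (xCoord L c k, yCoord L c k)
  tgt := (xCoord L c k, yCoord L c (finRotate n k))

/-- The `k`-th horizontal edge `(x_k, y_{k+1}) → (x_{k+1}, y_{k+1})` of component `c`, the index
`k + 1` being taken modulo `n`. -/
def horizontalEdge {n : ℕ} (L : GridLink n) (c : Fin 2) (k : Fin n) : OrientedEdge where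
  src := (xCoord L c k, yCoord L c (finRotate n k))
  tgt := (xCoord L c (finRotate n k), yCoord L c (finRotate n k))

/-- Two edges cross if they meet in a point interior to both. -/
def OrientedEdge.Crosses (e f : OrientedEdge) : Prop :=
  (openSegment ℝ e.src e.tgt ∩ openSegment ℝ f.src f.tgt).Nonempty

/-- The sign of the crossing of the edge `o` with the edge `w` passing below it: `+1` if
the direction of `w` is obtained from that of `o` by a counterclockwise turn by an angle
less than `π`, and `-1` if by a clockwise one. -/
def crossingSign (o w : OrientedEdge) : ℤ :=
  SignType.sign ((o.tgt.1 - o.src.1) * (w.tgt.2 - w.src.2)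
    - (o.tgt.2 - o.src.2) * (w.tgt.1 - w.src.1))

open Classical in
/-- The linking number: the sum of the signs of the crossings at which the first component passes
under the second one. As vertical edges always pass over horizontal ones in a grid diagram, these
are the crossings of a horizontal edge of the first component with a vertical edge of the second. -/
def linkingNumber {n : ℕ} (L : GridLink n) : ℤ :=
  ∑ k : Fin n, ∑ l : Fin n,
    if (verticalEdge L 1 l).Crosses (horizontalEdge L 0 k) then
      crossingSign (verticalEdge L 1 l) (horizontalEdge L 0 k)
    else 0

/-- The random 2-component link `L_n`: `σ` and `π` are chosen independently and uniformly at
random, that is, the pair `(σ, π)` is uniformly distributed on `S_{2n} × S_{2n}`. -/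
def randomLink (n : ℕ) : PMF (GridLink n) := PMF.uniformOfFintype (GridLink n)

/-- The normalized linking number `lk / n`. -/
def normalizedLk {n : ℕ} (L : GridLink n) : ℝ := (linkingNumber L : ℝ) / (n : ℝ)

/-- The distribution on `ℝ` of the normalized linking number of the random link `L_n`. -/
def normalizedLkLaw (n : ℕ) : Measure ℝ := ((randomLink n).map normalizedLk).toMeasure

/-- The expected value `E[(lk(L_n) / n)^u]`. -/
def normalizedLkMoment (n u : ℕ) : ℝ := ∫ x, x ^ u ∂(normalizedLkLaw n)

/-- All the moments of `μ` exist, and the `u`-th one is `m u`. -/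
def HasMoments (μ : Measure ℝ) (m : ℕ → ℝ) : Prop :=
  ∀ u : ℕ, Integrable (fun x : ℝ => x ^ u) μ ∧ ∫ x, x ^ u ∂μ = m u

/-- Weak convergence of distributions on `ℝ`: the distribution functions converge at each
continuity point of the limit distribution function. -/
def ConvergesWeakly (ν : ℕ → Measure ℝ) (μ : Measure ℝ) : Prop :=
  ∀ y : ℝ, ContinuousAt (fun x : ℝ => μ.real (Set.Iic x)) y →
    Tendsto (fun n => (ν n).real (Set.Iic y)) atTop (𝓝 (μ.real (Set.Iic y)))

end GridModel

end

namespace GridModel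

open scoped BigOperators

/-! ### The method of moments -/

/-! A vertical and a horizontal edge cross exactly when two betweenness conditions hold, one on
`x`-coordinates and one on `y`-coordinates. The linking number is therefore bilinear in differences
of order indicators, one factor depending on `σ` and one on `π` (`linkingNumber_eq`). Expanding the
`u`-th power and using independence gives a sum over index vectors `k, l` of products of two mixed
moments (`normalizedLkMoment_eq`).

Two symmetries of a uniform permutation control this sum. A mixed moment depends only on which
indices are equal or cyclically consecutive (`mixedMoment_congr`), and it vanishes when one index is
isolated, since exchanging two coordinates flips the sign (`mixedMoment_eq_zero`). The first factor
imposes this condition on `k`, the second on `l`. Without isolated indices, the graph of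
coincidences has at most `u / 2` components, and one value per component determines the vector.
Hence there are `O(n ^ (u / 2))` choices for each of `k` and `l`, which matches the normalisation `n
^ u`. Only patterns that pair up the indices survive in the limit, each with asymptotic count `n ^
(u / 2)` (`tendsto_patternCount`).

Encoding such pairings bounds the square of their number by `36 ^ u * u!`, hence also the limit
moments (`limitMoment_abs_le`). This growth makes the moments determine the law, and the method of
moments applies (`exists_limit_of_tendsto_moments`). The second moment is computed exactly for every
`n ≥ 2`. -/

lemma integrable_exp_mul_of_hasMoments {μ : Measure ℝ} {m : ℕ → ℝ} {C t : ℝ}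
    (hμ : HasMoments μ m) (hC : 0 ≤ C) (hm : ∀ u, |m u| ≤ C ^ u * u.factorial)
    (ht : |t| * C < 1) : Integrable (fun x : ℝ => Real.exp (t * x)) μ := by
  -- The exponential is dominated by `2 * cosh`, whose series has only nonnegative even terms. It
  -- can be integrated termwise, and the moment bound turns it into a geometric series of ratio
  -- `(|t| * C) ^ 2`.
  have hint : ∀ i : ℕ, ∫⁻ x, ENNReal.ofReal ((t * x) ^ (2 * i) / (2 * i).factorial) ∂μ
      ≤ ENNReal.ofReal (((|t| * C) ^ 2) ^ i) := by
    intro i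
    have hi : Integrable (fun x : ℝ => (t * x) ^ (2 * i) / (2 * i).factorial) μ := by
      simp_rw [mul_pow]
      exact ((hμ (2 * i)).1.const_mul _).div_const _
    rw [← ofReal_integral_eq_lintegral_ofReal hi]
    · apply ENNReal.ofReal_le_ofReal
      simp_rw [mul_pow t]
      rw [integral_div, integral_const_mul, (hμ (2 * i)).2, div_le_iff₀ (by positivity)]
      have h1 := (le_abs_self _).trans (hm (2 * i))
      have h2 : (t : ℝ) ^ (2 * i) = |t| ^ (2 * i) := by
        rw [pow_mul, pow_mul, sq_abs]
      calc t ^ (2 * i) * m (2 * i) ≤ t ^ (2 * i) * (C ^ (2 * i) * (2 * i).factorial) := by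
            apply mul_le_mul_of_nonneg_left h1
            rw [h2]; positivity
        _ = _ := by rw [h2, ← pow_mul, mul_pow]; ring
    · filter_upwards with x
      have : 0 ≤ (t * x) ^ (2 * i) := by rw [pow_mul]; positivity
      positivity
  have hcosh : ∫⁻ x, ENNReal.ofReal (Real.cosh (t * x)) ∂μ < ⊤ := by
    have : ∀ x : ℝ, ENNReal.ofReal (Real.cosh (t * x))
        = ∑' i : ℕ, ENNReal.ofReal ((t * x) ^ (2 * i) / (2 * i).factorial) := by
      intro x
      rw [Real.cosh_eq_tsum, ENNReal.ofReal_tsum_of_nonneg]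
      · intro i
        have : 0 ≤ (t * x) ^ (2 * i) := by rw [pow_mul]; positivity
        positivity
      · exact (Real.hasSum_cosh _).summable
    simp_rw [this]
    rw [lintegral_tsum (fun i => by fun_prop)]
    refine lt_of_le_of_lt (ENNReal.tsum_le_tsum hint) ?_
    rw [← ENNReal.ofReal_tsum_of_nonneg (fun i => by positivity)]
    · exact ENNReal.ofReal_lt_top
    · apply summable_geometric_of_lt_one (by positivity)
      have : 0 ≤ |t| * C := by positivity
      nlinarith
  refine Integrable.mono' (g := fun x => 2 * Real.cosh (t * x)) ?_ (by fun_prop) ?_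
  · refine Integrable.const_mul ⟨by fun_prop, ?_⟩ _
    rw [hasFiniteIntegral_iff_ofReal (by filter_upwards with x using (Real.cosh_pos _).le)]
    exact hcosh
  · filter_upwards with x
    rw [Real.norm_eq_abs, Real.abs_exp, Real.cosh_eq]
    linarith [Real.exp_pos (-(t * x))]

/-- A probability distribution whose moments grow at most like `C ^ u * u!` is determined by its
moments. -/
theorem eq_of_hasMoments {μ ν : Measure ℝ} [IsProbabilityMeasure μ] [IsProbabilityMeasure ν]
    {m : ℕ → ℝ} {C : ℝ} (hC : 0 < C) (hm : ∀ u, |m u| ≤ C ^ u * u.factorial)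
    (hμ : HasMoments μ m) (hν : HasMoments ν m) : μ = ν := by
  -- On this vertical strip both complex moment generating functions are analytic. Their derivatives
  -- at `0` are the moments, so they agree near `0`, hence on the whole connected strip. The strip
  -- contains the imaginary axis, where they are the characteristic functions.
  set S : Set ℂ := {z | z.re ∈ Set.Ioo (-C⁻¹) C⁻¹} with hS
  have hint : ∀ {ρ : Measure ℝ}, HasMoments ρ m → ∀ z ∈ S,
      z.re ∈ interior (integrableExpSet (id : ℝ → ℝ) ρ) := by
    intro ρ hρ z hz
    refine mem_interior.2 ⟨Set.Ioo (-C⁻¹) C⁻¹, fun t ht => ?_, isOpen_Ioo, hz⟩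
    refine integrable_exp_mul_of_hasMoments hρ hC.le hm ?_
    have := abs_lt.2 ht
    calc |t| * C < C⁻¹ * C := by gcongr
      _ = 1 := inv_mul_cancel₀ hC.ne'
  have h0 : (0 : ℂ) ∈ S := by simp [hS, hC]
  have hderiv : ∀ {ρ : Measure ℝ}, HasMoments ρ m → ∀ k : ℕ,
      iteratedDeriv k (complexMGF (id : ℝ → ℝ) ρ) 0 = (m k : ℂ) := by
    intro ρ hρ k
    rw [iteratedDeriv_complexMGF (hint hρ 0 h0), ← (hρ k).2, ← integral_complex_ofReal]
    simp
  have han : ∀ {ρ : Measure ℝ}, HasMoments ρ m →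
      AnalyticOnNhd ℂ (complexMGF (id : ℝ → ℝ) ρ) S :=
    fun hρ z hz => analyticAt_complexMGF (hint hρ z hz)
  have hconv : Convex ℝ S := (convex_Ioo (-C⁻¹) C⁻¹).linear_preimage Complex.reLm
  have hev : complexMGF (id : ℝ → ℝ) μ =ᶠ[𝓝 0] complexMGF (id : ℝ → ℝ) ν := by
    have h1 := (han hμ 0 h0).hasFPowerSeriesAt
    have h2 := (han hν 0 h0).hasFPowerSeriesAt
    simp_rw [hderiv hμ] at h1
    simp_rw [hderiv hν] at h2
    filter_upwards [h1.eventually_hasSum_sub, h2.eventually_hasSum_sub] with z hz1 hz2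
    exact hz1.unique hz2
  have heq := (han hμ).eqOn_of_preconnected_of_eventuallyEq (han hν) hconv.isPreconnected h0 hev
  apply Measure.ext_of_charFun
  ext t
  have ht : (t : ℂ) * Complex.I ∈ S := by simp [hS, hC]
  rw [← complexMGF_id_mul_I, ← complexMGF_id_mul_I]
  exact heq ht

lemma abs_sub_truncation_le (y : ℝ) {M : ℝ} (hM : 0 < M) :
    |y - max (-M) (min y M)| ≤ y ^ 2 / M := by
  rw [le_div_iff₀ hM]
  rcases le_total y (-M) with h | h
  · rw [min_eq_left (by linarith), max_eq_left h, abs_of_nonpos (by linarith)]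
    nlinarith
  · rcases le_total y M with h' | h'
    · rw [min_eq_left h', max_eq_right h]
      simp; positivity
    · rw [min_eq_right h', max_eq_right (by linarith), abs_of_nonneg (by linarith)]
      nlinarith

/-- The moments of a weak limit are the limits of the moments. -/
theorem hasMoments_of_tendsto {ν : ℕ → ProbabilityMeasure ℝ} {μ : ProbabilityMeasure ℝ}
    {m : ℕ → ℝ} (hlim : Tendsto ν atTop (𝓝 μ))
    (hint : ∀ n u, Integrable (fun x : ℝ => x ^ u) (ν n : Measure ℝ))
    (hm : ∀ u : ℕ, Tendsto (fun n => ∫ x, x ^ u ∂(ν n : Measure ℝ)) atTop (𝓝 (m u))) :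
    HasMoments (μ : Measure ℝ) m := by
  have hnn : ∀ (u : ℕ) (x : ℝ), 0 ≤ x ^ (2 * u) := fun u x => by rw [pow_mul]; positivity
  -- Weak convergence only gives lower semicontinuity here. This suffices for integrability;
  -- equality of the moments comes from the truncation in `key`.
  have hle : ∀ u : ℕ, ∫⁻ x, ENNReal.ofReal (x ^ (2 * u)) ∂(μ : Measure ℝ)
      ≤ ENNReal.ofReal (m (2 * u)) := by
    intro u
    refine (lintegral_le_liminf_lintegral_of_forall_isOpen_measure_le_liminf_measure
      (μs := fun n => (ν n : Measure ℝ)) (by fun_prop) (fun x => hnn u x)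
      (fun G hG => ProbabilityMeasure.le_liminf_measure_open_of_tendsto hlim hG)).trans ?_
    simp_rw [← fun n => ofReal_integral_eq_lintegral_ofReal (hint n (2 * u))
      (Eventually.of_forall (hnn u))]
    exact (((ENNReal.continuous_ofReal.tendsto _).comp (hm (2 * u))).liminf_eq).le
  have hint2 : ∀ u : ℕ, Integrable (fun x : ℝ => x ^ (2 * u)) (μ : Measure ℝ) := by
    intro u
    refine ⟨by fun_prop, ?_⟩
    rw [hasFiniteIntegral_iff_ofReal (Eventually.of_forall (hnn u))]
    exact (hle u).trans_lt ENNReal.ofReal_lt_top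
  have hintμ : ∀ u : ℕ, Integrable (fun x : ℝ => x ^ u) (μ : Measure ℝ) := by
    intro u
    refine Integrable.mono' ((integrable_const 1).add (hint2 u)) (by fun_prop) ?_
    filter_upwards with x
    simp only [Pi.add_apply, Real.norm_eq_abs]
    rw [mul_comm, pow_mul, ← sq_abs]
    nlinarith [abs_nonneg (x ^ u)]
  have hm0 : ∀ u, 0 ≤ m (2 * u) := fun u =>
    ge_of_tendsto' (hm (2 * u)) fun n => integral_nonneg (hnn u)
  have hle' : ∀ u : ℕ, ∫ x, x ^ (2 * u) ∂(μ : Measure ℝ) ≤ m (2 * u) := by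
    intro u
    have := hle u
    rw [← ofReal_integral_eq_lintegral_ofReal (hint2 u) (Eventually.of_forall (hnn u))] at this
    exact (ENNReal.ofReal_le_ofReal_iff (hm0 u)).1 this
  refine fun u => ⟨hintμ u, ?_⟩
  -- Truncating `x ^ u` at height `M` gives a bounded continuous function, whose integrals converge.
  -- The truncation error is at most the moment of order `2 * u` divided by `M`, uniformly along the
  -- sequence.
  have key : ∀ M : ℝ, 0 < M → |∫ x, x ^ u ∂(μ : Measure ℝ) - m u| ≤ 2 * m (2 * u) / M := by
    intro M hM
    let g : BoundedContinuousFunction ℝ ℝ :=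
      BoundedContinuousFunction.ofNormedAddCommGroup (fun x => max (-M) (min (x ^ u) M))
        (by fun_prop) M (fun x => by
          rw [Real.norm_eq_abs, abs_le]
          exact ⟨le_max_left _ _, max_le (by linarith) (min_le_right _ _)⟩)
    have hg : ∀ ρ : ProbabilityMeasure ℝ, (∀ w, Integrable (fun x : ℝ => x ^ w) (ρ : Measure ℝ)) →
        |∫ x, x ^ u ∂(ρ : Measure ℝ) - ∫ x, g x ∂(ρ : Measure ℝ)|
          ≤ (∫ x, x ^ (2 * u) ∂(ρ : Measure ℝ)) / M := by
      intro ρ hρ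
      rw [← integral_sub (hρ u) (g.integrable _), ← integral_div]
      refine abs_integral_le_integral_abs.trans (integral_mono ?_ ((hρ (2 * u)).div_const M) ?_)
      · exact ((hρ u).sub (g.integrable _)).abs
      · intro x
        have := abs_sub_truncation_le (x ^ u) hM
        rwa [← pow_mul, mul_comm u 2] at this
    have hgt : Tendsto (fun n => ∫ x, g x ∂(ν n : Measure ℝ)) atTop
        (𝓝 (∫ x, g x ∂(μ : Measure ℝ))) :=
      ProbabilityMeasure.tendsto_iff_forall_integral_tendsto.1 hlim g
    have h1 : |m u - ∫ x, g x ∂(μ : Measure ℝ)| ≤ m (2 * u) / M :=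
      le_of_tendsto_of_tendsto' (((hm u).sub hgt).abs) ((hm (2 * u)).div_const M)
        (fun n => hg (ν n) (hint n))
    have h2 := (hg μ hintμ).trans (div_le_div_of_nonneg_right (hle' u) hM.le)
    rw [abs_sub_comm] at h1
    calc |∫ x, x ^ u ∂(μ : Measure ℝ) - m u| ≤ _ := abs_sub_le _ (∫ x, g x ∂(μ : Measure ℝ)) _
      _ ≤ m (2 * u) / M + m (2 * u) / M := add_le_add h2 h1
      _ = _ := by ring
  have hlim0 : Tendsto (fun M : ℝ => 2 * m (2 * u) / M) atTop (𝓝 0) :=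
    tendsto_const_nhds.div_atTop tendsto_id
  have := ge_of_tendsto hlim0 ((eventually_gt_atTop 0).mono key)
  exact sub_eq_zero.1 (abs_eq_zero.1 (le_antisymm this (abs_nonneg _)))

/-- Chebyshev's inequality bounds the mass outside `[-r, r]` by `B / r ^ 2`. -/
lemma isTightMeasureSet_of_second_moment_le {S : Set (Measure ℝ)} {B : ℝ}
    (hint : ∀ μ ∈ S, Integrable (fun x : ℝ => x ^ 2) μ) (hB : ∀ μ ∈ S, ∫ x, x ^ 2 ∂μ ≤ B) :
    IsTightMeasureSet S := by
  apply isTightMeasureSet_of_tendsto_measure_norm_gt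
  have hlim0 : Tendsto (fun r : ℝ => ENNReal.ofReal (B / r ^ 2)) atTop (𝓝 0) := by
    rw [← ENNReal.ofReal_zero]
    exact (ENNReal.continuous_ofReal.tendsto _).comp
      (tendsto_const_nhds.div_atTop (tendsto_pow_atTop (by norm_num)))
  refine tendsto_of_tendsto_of_tendsto_of_le_of_le' tendsto_const_nhds hlim0
    (Eventually.of_forall fun _ => zero_le) ?_
  filter_upwards [eventually_gt_atTop 0] with r hr
  refine iSup₂_le fun μ hμ => ?_
  have h := mul_meas_ge_le_lintegral₀ (μ := μ) (f := fun x : ℝ => ENNReal.ofReal (x ^ 2))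
    (by fun_prop) (ENNReal.ofReal (r ^ 2))
  rw [← ofReal_integral_eq_lintegral_ofReal (hint μ hμ)
    (Eventually.of_forall fun x => by positivity)] at h
  have hsub : {x : ℝ | r < ‖x‖} ⊆ {x | ENNReal.ofReal (r ^ 2) ≤ ENNReal.ofReal (x ^ 2)} := by
    intro x hx
    apply ENNReal.ofReal_le_ofReal
    have : r < |x| := hx
    rw [← sq_abs x]
    gcongr
  rw [ENNReal.ofReal_div_of_pos (by positivity), ENNReal.le_div_iff_mul_le
    (by left; simpa using hr.ne') (by left; simp), mul_comm]
  calc _ ≤ _ := by gcongr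
    _ ≤ _ := h
    _ ≤ _ := ENNReal.ofReal_le_ofReal (hB μ hμ)

/-- The method of moments: convergence of all moments to a sequence that grows at most like
`C ^ u * u!` implies weak convergence to a distribution with these moments. -/
theorem exists_limit_of_tendsto_moments {ν : ℕ → ProbabilityMeasure ℝ} {m : ℕ → ℝ} {C : ℝ}
    (hC : 0 < C) (hmC : ∀ u, |m u| ≤ C ^ u * u.factorial)
    (hint : ∀ n u, Integrable (fun x : ℝ => x ^ u) (ν n : Measure ℝ))
    (hm : ∀ u : ℕ, Tendsto (fun n => ∫ x, x ^ u ∂(ν n : Measure ℝ)) atTop (𝓝 (m u))) :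
    ∃ μ : ProbabilityMeasure ℝ, HasMoments (μ : Measure ℝ) m ∧ Tendsto ν atTop (𝓝 μ) := by
  obtain ⟨B, hB⟩ := (hm 2).bddAbove_range
  have hcomp : IsCompact (closure (Set.range ν)) := by
    apply isCompact_closure_of_isTightMeasureSet
    apply isTightMeasureSet_of_second_moment_le (B := B)
    · rintro _ ⟨_, ⟨n, rfl⟩, rfl⟩
      exact hint n 2
    · rintro _ ⟨_, ⟨n, rfl⟩, rfl⟩
      exact hB ⟨n, rfl⟩
  -- By tightness and Prokhorov's theorem every subsequence has a convergent further subsequence.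
  -- All these limits have moments `m`, so determinacy identifies them and the whole sequence
  -- converges.
  have hsub : ∀ ns : ℕ → ℕ, Tendsto ns atTop atTop → ∃ μ : ProbabilityMeasure ℝ,
      HasMoments (μ : Measure ℝ) m ∧ ∃ ms : ℕ → ℕ, Tendsto (fun n => ν (ns (ms n))) atTop (𝓝 μ) := by
    intro ns hns
    obtain ⟨μ, -, ms, hms, hlim⟩ := hcomp.isSeqCompact
      (x := fun n => ν (ns n)) (fun n => subset_closure ⟨_, rfl⟩)
    refine ⟨μ, hasMoments_of_tendsto hlim (fun n u => hint _ u) (fun u => ?_), ms, hlim⟩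
    exact (hm u).comp (hns.comp hms.tendsto_atTop)
  obtain ⟨μ, hμ, -⟩ := hsub id tendsto_id
  refine ⟨μ, hμ, tendsto_of_subseq_tendsto fun ns hns => ?_⟩
  obtain ⟨μ', hμ', ms, hlim⟩ := hsub ns hns
  have h : (μ' : Measure ℝ) = (μ : Measure ℝ) := eq_of_hasMoments hC hmC hμ' hμ
  have : μ' = μ := Subtype.ext h
  exact ⟨ms, this ▸ hlim⟩

/-- The portmanteau theorem applies to `Set.Iic y` because an atom at its frontier point `y` would
be a jump of the distribution function. -/
lemma convergesWeakly_of_tendsto {ν : ℕ → ProbabilityMeasure ℝ} {μ : ProbabilityMeasure ℝ}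
    (hlim : Tendsto ν atTop (𝓝 μ)) :
    ConvergesWeakly (fun n => (ν n : Measure ℝ)) (μ : Measure ℝ) := by
  intro y hy
  have hnull : (μ : Measure ℝ) (frontier (Set.Iic y)) = 0 := by
    rw [frontier_Iic]
    by_contra hne
    have hpos : 0 < (μ : Measure ℝ).real {y} :=
      ENNReal.toReal_pos hne (measure_ne_top _ _)
    have hle : ∀ x < y, (μ : Measure ℝ).real (Set.Iic x)
        ≤ (μ : Measure ℝ).real (Set.Iic y) - (μ : Measure ℝ).real {y} := by
      intro x hx
      rw [le_sub_iff_add_le, ← measureReal_union (by simpa using hx) (measurableSet_singleton y)]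
      refine measureReal_mono (Set.union_subset (Set.Iic_subset_Iic.2 hx.le) (by simp))
        (measure_ne_top _ _)
    have h1 := le_of_tendsto (hy.tendsto.mono_left nhdsWithin_le_nhds)
      (eventually_nhdsWithin_of_forall (s := Set.Iio y) hle)
    linarith
  exact (ENNReal.tendsto_toReal (measure_ne_top _ _)).comp
    (ProbabilityMeasure.tendsto_measure_of_null_frontier_of_tendsto' hlim hnull)

/-! ### Exchangeability of a uniform permutation -/

/-- Average in addition over relabellings `τ` of `κ`. Each `τ` extends to a permutation of `Fin N`,
so it does not change the expectation over `σ`. For fixed `σ`, the ranking of the chosen values runs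
once through all bijections as `τ` varies. The right-hand side no longer involves `N` or `p`. -/
lemma expect_perm_order_of_injective {κ : Type*} [Fintype κ] [DecidableEq κ] {N : ℕ}
    {p : κ → Fin N} (hp : Function.Injective p) (g : (κ → κ → Prop) → ℝ) :
    𝔼 σ : Equiv.Perm (Fin N), g (fun s t => σ (p s) < σ (p t)) =
      𝔼 e : κ ≃ Fin (Fintype.card κ), g (fun s t => e s < e t) := by
  have hinner : ∀ τ : Equiv.Perm κ,
      𝔼 σ : Equiv.Perm (Fin N), g (fun s t => σ (p (τ s)) < σ (p (τ t))) =
      𝔼 σ : Equiv.Perm (Fin N), g (fun s t => σ (p s) < σ (p t)) := by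
    intro τ
    have hext : ∀ s, (τ.viaFintypeEmbedding ⟨p, hp⟩) (p s) = p (τ s) := fun s =>
      Equiv.Perm.viaFintypeEmbedding_apply_image τ ⟨p, hp⟩ s
    refine Fintype.expect_equiv (Equiv.mulRight (τ.viaFintypeEmbedding ⟨p, hp⟩)) _ _ fun σ => ?_
    simp [hext]
  have houter : ∀ σ : Equiv.Perm (Fin N),
      𝔼 τ : Equiv.Perm κ, g (fun s t => σ (p (τ s)) < σ (p (τ t))) =
      𝔼 e : κ ≃ Fin (Fintype.card κ), g (fun s t => e s < e t) := by
    intro σ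
    have hinj : Function.Injective fun s => σ (p s) := σ.injective.comp hp
    let S : Finset (Fin N) := Finset.univ.image fun s => σ (p s)
    have hS : S.card = Fintype.card κ := Finset.card_image_of_injective _ hinj
    let o := S.orderIsoOfFin hS
    let r : κ ≃ S := Equiv.ofBijective (fun s => ⟨σ (p s), Finset.mem_image_of_mem _ (by simp)⟩)
      ⟨fun s t h => hinj (congrArg Subtype.val h), fun ⟨x, hx⟩ => by
        obtain ⟨s, -, rfl⟩ := Finset.mem_image.1 hx
        exact ⟨s, rfl⟩⟩
    let e₀ : κ ≃ Fin (Fintype.card κ) := r.trans o.symm.toEquiv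
    refine Fintype.expect_equiv (Equiv.equivCongr (Equiv.refl κ) e₀) _ _ fun τ => ?_
    congr 1
    ext s t
    simp only [Equiv.equivCongr_apply_apply, Equiv.refl_symm, Equiv.refl_apply, e₀, Equiv.trans_apply]
    exact (o.symm.lt_iff_lt (x := r (τ s)) (y := r (τ t))).symm
  calc _ = 𝔼 _τ : Equiv.Perm κ, 𝔼 σ : Equiv.Perm (Fin N), g (fun s t => σ (p s) < σ (p t)) := by
        rw [Fintype.expect_const]
    _ = 𝔼 τ : Equiv.Perm κ, 𝔼 σ : Equiv.Perm (Fin N),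
          g (fun s t => σ (p (τ s)) < σ (p (τ t))) := by simp_rw [hinner]
    _ = _ := by rw [Finset.expect_comm]; simp_rw [houter]; rw [Fintype.expect_const]

/-- The relative order of the values of a uniform permutation at given arguments has a
distribution that depends only on which of the arguments coincide. -/
lemma expect_perm_order_congr {ι : Type*} [Finite ι] {N N' : ℕ} {p : ι → Fin N} {p' : ι → Fin N'}
    (h : ∀ s t, p s = p t ↔ p' s = p' t) (g : (ι → ι → Prop) → ℝ) :
    𝔼 σ : Equiv.Perm (Fin N), g (fun s t => σ (p s) < σ (p t)) =
      𝔼 σ : Equiv.Perm (Fin N'), g (fun s t => σ (p' s) < σ (p' t)) := by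
  classical
  let κ := Quotient (Setoid.ker p)
  have := Fintype.ofFinite ι
  let q : κ → Fin N := Quotient.lift p fun _ _ h => h
  let q' : κ → Fin N' := Quotient.lift p' fun s t hst => (h s t).1 hst
  have hq : Function.Injective q := by
    rintro ⟨s⟩ ⟨t⟩ hst
    exact Quotient.sound hst
  have hq' : Function.Injective q' := by
    rintro ⟨s⟩ ⟨t⟩ hst
    exact Quotient.sound ((h s t).2 hst)
  let g' : (κ → κ → Prop) → ℝ := fun R => g fun s t => R (Quotient.mk _ s) (Quotient.mk _ t)
  exact (expect_perm_order_of_injective hq g').trans (expect_perm_order_of_injective hq' g').symm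

/-! ### Mixed moments of half crossings -/

lemma position_inj {n : ℕ} {c c' : Fin 2} {k k' : Fin n} :
    position c k = position c' k' ↔ c = c' ∧ k = k' := by
  simp [position]

/-- The difference `1(z_k < z'_l) - 1(z_{k+1} < z'_l)`, where `z` are the coordinates of the
component `c` and `z'` those of the component `c'`. -/
noncomputable def halfCrossing {n : ℕ} [NeZero n] (σ : Equiv.Perm (Fin (2 * n))) (c c' : Fin 2)
    (k l : Fin n) : ℝ :=
  (if σ (position c k) < σ (position c' l) then 1 else 0) -
    (if σ (position c (k + 1)) < σ (position c' l) then 1 else 0)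

lemma halfCrossing_abs_le {n : ℕ} [NeZero n] (σ : Equiv.Perm (Fin (2 * n))) (c c' : Fin 2)
    (k l : Fin n) : |halfCrossing σ c c' k l| ≤ 1 := by
  unfold halfCrossing
  split_ifs <;> simp

/-- The mixed moments of half crossings for a uniform permutation. -/
noncomputable def mixedMoment {n : ℕ} [NeZero n] {ι : Type*} [Fintype ι] (c c' : Fin 2)
    (k l : ι → Fin n) : ℝ :=
  𝔼 σ : Equiv.Perm (Fin (2 * n)), ∏ i, halfCrossing σ c c' (k i) (l i)

lemma mixedMoment_abs_le {n : ℕ} [NeZero n] {ι : Type*} [Fintype ι] (c c' : Fin 2)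
    (k l : ι → Fin n) : |mixedMoment c c' k l| ≤ 1 := by
  refine (Finset.abs_expect_le _ _).trans (Finset.expect_le Finset.univ_nonempty fun σ _ => ?_)
  rw [Finset.abs_prod]
  exact Finset.prod_le_one (fun _ _ => abs_nonneg _) fun i _ => halfCrossing_abs_le _ _ _ _ _

/-- Which of the entries of a cyclic index vector are equal or consecutive. -/
def adjacencyPattern {n : ℕ} [NeZero n] {ι : Type*} (k : ι → Fin n) : ι → ι → Bool × Bool :=
  fun i j => (decide (k i = k j), decide (k i = k j + 1))

lemma adjacencyPattern_eq_iff {n n' : ℕ} [NeZero n] [NeZero n'] {ι : Type*} {k : ι → Fin n}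
    {k' : ι → Fin n'} : adjacencyPattern k = adjacencyPattern k' ↔
      ∀ i j, (k i = k j ↔ k' i = k' j) ∧ (k i = k j + 1 ↔ k' i = k' j + 1) := by
  simp [adjacencyPattern, funext_iff]

/-- The product only sees the relative order of `σ` at the positions of `k i`, `k i + 1` and `l i`.
The hypotheses fix which of these coincide; for `l`, equality alone matters. -/
lemma mixedMoment_congr {n n' : ℕ} [NeZero n] [NeZero n'] {ι : Type*} [Fintype ι] {c c' : Fin 2}
    (hc : c ≠ c') {k l : ι → Fin n} {k' l' : ι → Fin n'}
    (hk : adjacencyPattern k = adjacencyPattern k') (hl : ∀ i j, l i = l j ↔ l' i = l' j) :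
    mixedMoment c c' k l = mixedMoment c c' k' l' := by
  classical
  have hk' := adjacencyPattern_eq_iff.1 hk
  let p : ι ⊕ ι ⊕ ι → Fin (2 * n) := Sum.elim (fun i => position c (k i))
    (Sum.elim (fun i => position c (k i + 1)) (fun i => position c' (l i)))
  let p' : ι ⊕ ι ⊕ ι → Fin (2 * n') := Sum.elim (fun i => position c (k' i))
    (Sum.elim (fun i => position c (k' i + 1)) (fun i => position c' (l' i)))
  let g : (ι ⊕ ι ⊕ ι → ι ⊕ ι ⊕ ι → Prop) → ℝ := fun R =>
    ∏ i, ((if R (Sum.inl i) (Sum.inr (Sum.inr i)) then 1 else 0) -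
      (if R (Sum.inr (Sum.inl i)) (Sum.inr (Sum.inr i)) then 1 else 0))
  have h := expect_perm_order_congr (p := p) (p' := p') ?_ g
  · simp only [mixedMoment, halfCrossing]
    convert h <;> rfl
  · have e1 := fun i j => (hk' i j).1
    have e2 := fun i j => (hk' i j).2
    have e3 : ∀ i j, k i + 1 = k j ↔ k' i + 1 = k' j := fun i j => by
      rw [eq_comm, e2 j i, eq_comm]
    rintro (i | i | i) (j | j | j) <;>
      simp [p, p', position_inj, hc, hc.symm, e1, e2, e3, hl]

/-- A mixed moment vanishes if one of the indices is isolated: exchange the two coordinates that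
belong to it. -/
lemma mixedMoment_eq_zero {n : ℕ} [NeZero n] {ι : Type*} [Fintype ι] {c c' : Fin 2}
    (hc : c ≠ c') {k l : ι → Fin n} {i : ι}
    (hi : ∀ j, j ≠ i → k j ≠ k i ∧ k j ≠ k i + 1 ∧ k i ≠ k j + 1) :
    mixedMoment c c' k l = 0 := by
  classical
  have key : mixedMoment c c' k l = -mixedMoment c c' k l := by
    unfold mixedMoment
    rw [← Finset.expect_neg_distrib]
    refine Fintype.expect_equiv
      (Equiv.mulRight (Equiv.swap (position c (k i)) (position c (k i + 1)))) _ _ fun σ => ?_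
    have hl : ∀ j, Equiv.swap (position c (k i)) (position c (k i + 1)) (position c' (l j))
        = position c' (l j) := fun j =>
      Equiv.swap_apply_of_ne_of_ne (by simp [position_inj, hc.symm])
        (by simp [position_inj, hc.symm])
    rw [← Finset.mul_prod_erase _ _ (Finset.mem_univ i),
      ← Finset.mul_prod_erase _ _ (Finset.mem_univ i), ← neg_mul]
    congr 1
    · simp [halfCrossing, hl]
    · refine Finset.prod_congr rfl fun j hj => ?_
      obtain ⟨h1, h2, h3⟩ := hi j (Finset.ne_of_mem_erase hj)
      have h4 : Equiv.swap (position c (k i)) (position c (k i + 1)) (position c (k j))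
          = position c (k j) :=
        Equiv.swap_apply_of_ne_of_ne (by simpa [position_inj] using h1)
          (by simpa [position_inj] using h2)
      have h5 : Equiv.swap (position c (k i)) (position c (k i + 1)) (position c (k j + 1))
          = position c (k j + 1) :=
        Equiv.swap_apply_of_ne_of_ne (by simpa [position_inj] using h3.symm)
          (by simpa [position_inj] using h1)
      simp [halfCrossing, hl, h4, h5]
  linarith

/-! ### The linking number as a bilinear expression -/

/-- The hypothesis excludes the degenerate segment `{a}`, which occurs for `n = 1`. -/
lemma mem_openSegment_iff {a b x : ℝ} (ha : x ≠ a) :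
    x ∈ openSegment ℝ a b ↔ (a < x ∧ x < b) ∨ (b < x ∧ x < a) := by
  rcases lt_trichotomy a b with h | h | h
  · rw [openSegment_eq_Ioo h, Set.mem_Ioo]
    constructor
    · exact Or.inl
    · rintro (h' | h')
      · exact h'
      · linarith
  · subst h
    rw [openSegment_same, Set.mem_singleton_iff]
    refine ⟨fun h => absurd h ha, ?_⟩
    rintro (h' | h') <;> linarith
  · rw [openSegment_symm, openSegment_eq_Ioo h, Set.mem_Ioo]
    constructor
    · exact Or.inr
    · rintro (h' | h')
      · linarith
      · exact h'

lemma crosses_iff {a b₁ b₂ c₁ c₂ d : ℝ} :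
    OrientedEdge.Crosses ⟨(a, b₁), (a, b₂)⟩ ⟨(c₁, d), (c₂, d)⟩ ↔
      a ∈ openSegment ℝ c₁ c₂ ∧ d ∈ openSegment ℝ b₁ b₂ := by
  constructor
  · rintro ⟨z, ⟨s, t, hs, ht, hst, rfl⟩, s', t', hs', ht', hst', hz⟩
    simp only [Prod.smul_mk, Prod.mk_add_mk, smul_eq_mul, Prod.mk.injEq, ← add_mul, hst, hst',
      one_mul] at hz
    exact ⟨⟨s', t', hs', ht', hst', by simpa using hz.1⟩, ⟨s, t, hs, ht, hst, by simpa using hz.2.symm⟩⟩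
  · rintro ⟨⟨s', t', hs', ht', hst', h1⟩, ⟨s, t, hs, ht, hst, h2⟩⟩
    refine ⟨(a, d), ⟨s, t, hs, ht, hst, ?_⟩, ⟨s', t', hs', ht', hst', ?_⟩⟩
    · simp only [Prod.smul_mk, Prod.mk_add_mk, smul_eq_mul, ← add_mul, hst, one_mul]
      rw [← h2]; simp
    · simp only [Prod.smul_mk, Prod.mk_add_mk, smul_eq_mul, ← add_mul, hst', one_mul]
      rw [← h1]; simp

-- Each difference of indicators is zero unless the point lies strictly between the endpoints, and
-- then it is the direction of the edge. For perpendicular edges the determinant in `crossingSign`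
-- is minus the product of the two directed lengths.
open Classical in
lemma signed_crossing_eq {a b₁ b₂ c₁ c₂ d : ℝ} (h₁ : a ≠ c₁) (h₂ : a ≠ c₂) (h₃ : d ≠ b₁)
    (h₄ : d ≠ b₂) :
    ((if OrientedEdge.Crosses ⟨(a, b₁), (a, b₂)⟩ ⟨(c₁, d), (c₂, d)⟩ then
      crossingSign ⟨(a, b₁), (a, b₂)⟩ ⟨(c₁, d), (c₂, d)⟩ else 0 : ℤ) : ℝ) =
    -(((if c₁ < a then 1 else 0) - (if c₂ < a then 1 else 0)) *
      ((if b₁ < d then 1 else 0) - (if b₂ < d then 1 else 0))) := by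
  rw [crosses_iff, mem_openSegment_iff h₁, mem_openSegment_iff h₃]
  simp only [crossingSign, sub_self, zero_mul, zero_sub]
  rcases lt_or_gt_of_ne h₁ with h1 | h1 <;> rcases lt_or_gt_of_ne h₂ with h2 | h2 <;>
  rcases lt_or_gt_of_ne h₃ with h3 | h3 <;> rcases lt_or_gt_of_ne h₄ with h4 | h4 <;>
  simp only [h1, h2, h3, h4, h1.not_gt, h2.not_gt, h3.not_gt, h4.not_gt, and_true, and_false,
    or_true, or_false, if_true, if_false, sub_self, mul_zero,
    neg_zero, Int.cast_zero, sub_zero, zero_sub, mul_one, mul_neg, neg_neg]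
  · rw [sign_neg (by nlinarith)]; simp
  · rw [sign_pos (by nlinarith)]; simp
  · rw [sign_pos (by nlinarith)]; simp
  · rw [sign_neg (by nlinarith)]; simp

/-- The horizontal edge number `k` lies at height `y_{k+1}`, hence the shift in the second factor.
Injectivity of `σ` and `π` provides the general position needed. -/
lemma linkingNumber_eq {n : ℕ} [NeZero n] (L : GridLink n) :
    (linkingNumber L : ℝ) =
      -∑ k, ∑ l, halfCrossing L.1 0 1 k l * halfCrossing L.2 1 0 l (k + 1) := by
  have hne : ∀ (σ : Equiv.Perm (Fin (2 * n))) (c c' : Fin 2) (k l : Fin n), c ≠ c' →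
      (((σ (position c k) : ℕ) : ℝ) + 1) ≠ ((σ (position c' l) : ℕ) : ℝ) + 1 := by
    intro σ c c' k l hc h
    have h' : σ (position c k) = σ (position c' l) := by
      apply Fin.ext
      exact_mod_cast add_right_cancel h
    exact hc (position_inj.1 (σ.injective h')).1
  simp only [linkingNumber, Int.cast_sum]
  rw [← Finset.sum_neg_distrib]
  refine Finset.sum_congr rfl fun k _ => ?_
  rw [← Finset.sum_neg_distrib]
  refine Finset.sum_congr rfl fun l _ => ?_
  refine (signed_crossing_eq (hne L.1 1 0 l k (by simp)) (hne L.1 1 0 l (finRotate n k) (by simp))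
    (hne L.2 0 1 (finRotate n k) l (by simp))
    (hne L.2 0 1 (finRotate n k) (finRotate n l) (by simp))).trans ?_
  simp [halfCrossing, finRotate_apply]

lemma normalizedLkMoment_eq_expect {n : ℕ} (u : ℕ) :
    normalizedLkMoment n u = 𝔼 L : GridLink n, ((linkingNumber L : ℝ) / n) ^ u := by
  let _ : MeasurableSpace (GridLink n) := ⊤
  have hmeas : Measurable (normalizedLk : GridLink n → ℝ) := measurable_from_top
  rw [normalizedLkMoment, normalizedLkLaw, ← PMF.toMeasure_map _ _ hmeas,
    integral_map hmeas.aemeasurable (by fun_prop), PMF.integral_eq_sum,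
    Fintype.expect_eq_sum_div_card, Finset.sum_div]
  refine Finset.sum_congr rfl fun L _ => ?_
  simp [randomLink, normalizedLk, div_eq_inv_mul]

lemma normalizedLkMoment_eq {n : ℕ} [NeZero n] (u : ℕ) :
    normalizedLkMoment n u = (-1) ^ u * (∑ k : Fin u → Fin n, ∑ l : Fin u → Fin n,
      mixedMoment 0 1 k l * mixedMoment 1 0 l (fun i => k i + 1)) / n ^ u := by
  have hpow : ∀ L : GridLink n, (linkingNumber L : ℝ) ^ u = (-1) ^ u *
      ∑ k : Fin u → Fin n, ∑ l : Fin u → Fin n,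
        (∏ i, halfCrossing L.1 0 1 (k i) (l i)) * ∏ i, halfCrossing L.2 1 0 (l i) (k i + 1) := by
    intro L
    rw [linkingNumber_eq, ← neg_one_mul, mul_pow, ← Fintype.sum_prod_type', Fintype.sum_pow,
      ← Fintype.sum_prod_type']
    congr 1
    refine Fintype.sum_equiv (Equiv.arrowProdEquivProdArrow (Fin u) _ _) _ _ fun p => ?_
    rw [← Finset.prod_mul_distrib]
    rfl
  rw [normalizedLkMoment_eq_expect]
  simp_rw [div_pow, hpow]
  rw [← Finset.expect_div, ← Finset.mul_expect, Finset.expect_sum_comm]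
  simp_rw [Finset.expect_sum_comm]
  congr 2
  refine Finset.sum_congr rfl fun k _ => Finset.sum_congr rfl fun l _ => ?_
  rw [mixedMoment, mixedMoment, Fintype.expect_mul_expect, ← Finset.expect_product',
    Finset.univ_product_univ]

instance {n : ℕ} : IsProbabilityMeasure (normalizedLkLaw n) := by
  unfold normalizedLkLaw
  infer_instance

lemma integrable_normalizedLkLaw (n : ℕ) (f : ℝ → ℝ) (hf : Measurable f) :
    Integrable f (normalizedLkLaw n) := by
  let _ : MeasurableSpace (GridLink n) := ⊤
  have hmeas : Measurable (normalizedLk : GridLink n → ℝ) := measurable_from_top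
  rw [normalizedLkLaw, ← PMF.toMeasure_map _ _ hmeas,
    integrable_map_measure hf.aestronglyMeasurable hmeas.aemeasurable]
  exact .of_finite

/-! ### Counting index vectors with a given adjacency pattern -/

variable {ι : Type*}

/-- The graph in which two indices are adjacent if the corresponding entries of an index vector
with the pattern `D` are equal or consecutive. -/
def patternGraph (D : ι → ι → Bool × Bool) : SimpleGraph ι :=
  SimpleGraph.fromRel fun i j => (D i j).1 = true ∨ (D i j).2 = true

open Classical in
/-- The number of index vectors in `Fin (n + 1)` with a given pattern. -/
noncomputable def patternCount [Fintype ι] (n : ℕ) (D : ι → ι → Bool × Bool) : ℕ :=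
  (Finset.univ.filter fun k : ι → Fin (n + 1) => adjacencyPattern k = D).card

lemma patternGraph_adj_adjacencyPattern {n : ℕ} [NeZero n] {k : ι → Fin n} {i j : ι} :
    (patternGraph (adjacencyPattern k)).Adj i j ↔
      i ≠ j ∧ (k i = k j ∨ k i = k j + 1 ∨ k j = k i + 1) := by
  simp only [patternGraph, SimpleGraph.fromRel_adj, adjacencyPattern, decide_eq_true_eq]
  rw [eq_comm (a := k j) (b := k i)]
  tauto

lemma eq_of_reachable {n : ℕ} [NeZero n] {k k' : ι → Fin n}
    (hkk : adjacencyPattern k = adjacencyPattern k') {i j : ι}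
    (hij : (patternGraph (adjacencyPattern k)).Reachable i j) (hi : k i = k' i) : k j = k' j := by
  obtain ⟨w⟩ := hij
  induction w with
  | nil => exact hi
  | cons h _ ih =>
    apply ih
    have hpat := adjacencyPattern_eq_iff.1 hkk
    obtain ⟨-, h1 | h1 | h1⟩ := patternGraph_adj_adjacencyPattern.1 h
    · rw [← (hpat _ _).1.1 h1, ← h1, hi]
    · have h2 := (hpat _ _).2.1 h1
      rw [h1, h2] at hi
      exact add_right_cancel hi
    · rw [(hpat _ _).2.1 h1, h1, hi]

variable [Fintype ι]

/-- The pattern fixes the difference of the entries along each edge of the graph, so one value per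
component determines the vector. -/
lemma patternCount_le_pow (n : ℕ) (D : ι → ι → Bool × Bool) :
    patternCount n D ≤ (n + 1) ^ Nat.card (patternGraph D).ConnectedComponent := by
  classical
  have : (n + 1) ^ Nat.card (patternGraph D).ConnectedComponent
      = Fintype.card ((patternGraph D).ConnectedComponent → Fin (n + 1)) := by
    simp [Nat.card_eq_fintype_card]
  rw [this, ← Finset.card_univ, patternCount]
  refine Finset.card_le_card_of_injOn (fun k C => k C.out) (fun _ _ => by simp) ?_
  intro k hk k' hk' h
  simp only [Finset.coe_filter, Finset.mem_univ, true_and, Set.mem_ofPred_eq] at hk hk'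
  subst hk
  ext1 i
  have hr : (patternGraph (adjacencyPattern k)).Reachable
      (((patternGraph (adjacencyPattern k)).connectedComponentMk i).out) i :=
    SimpleGraph.ConnectedComponent.exact (Quot.out_eq _)
  exact eq_of_reachable hk'.symm hr (congrFun h _)

lemma card_fiber_ge_two [DecidableEq ι] {G : SimpleGraph ι} [DecidableEq G.ConnectedComponent]
    (hG : ∀ i, ∃ j, G.Adj i j) (C : G.ConnectedComponent) :
    2 ≤ (Finset.univ.filter fun i => G.connectedComponentMk i = C).card := by
  induction C using SimpleGraph.ConnectedComponent.ind with
  | h i =>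
    obtain ⟨j, hj⟩ := hG i
    have : ({i, j} : Finset ι) ⊆ Finset.univ.filter fun x =>
        G.connectedComponentMk x = G.connectedComponentMk i := by
      intro x hx
      rcases Finset.mem_insert.1 hx with rfl | hx
      · simp
      · rw [Finset.mem_singleton] at hx
        subst hx
        simpa using SimpleGraph.ConnectedComponent.sound hj.reachable.symm
    calc 2 = ({i, j} : Finset ι).card := (Finset.card_pair hj.ne).symm
      _ ≤ _ := Finset.card_le_card this

lemma card_eq_sum_fiber [DecidableEq ι] (G : SimpleGraph ι) [DecidableEq G.ConnectedComponent]
    [Fintype G.ConnectedComponent] : Fintype.card ι =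
      ∑ C : G.ConnectedComponent,
        (Finset.univ.filter fun i => G.connectedComponentMk i = C).card := by
  rw [← Finset.card_univ]
  exact Finset.card_eq_sum_card_fiberwise (fun _ _ => by simp)

lemma two_mul_card_connectedComponent_le {G : SimpleGraph ι} (hG : ∀ i, ∃ j, G.Adj i j) :
    2 * Nat.card G.ConnectedComponent ≤ Fintype.card ι := by
  classical
  rw [card_eq_sum_fiber G, Nat.card_eq_fintype_card, mul_comm, ← smul_eq_mul, ← Finset.card_univ]
  exact Finset.card_nsmul_le_sum _ _ _ fun C _ => card_fiber_ge_two hG C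

lemma card_fiber_eq_two [DecidableEq ι] {G : SimpleGraph ι} [DecidableEq G.ConnectedComponent]
    (hG : ∀ i, ∃ j, G.Adj i j) (hcard : 2 * Nat.card G.ConnectedComponent = Fintype.card ι)
    (C : G.ConnectedComponent) :
    (Finset.univ.filter fun i => G.connectedComponentMk i = C).card = 2 := by
  have : Fintype G.ConnectedComponent := Fintype.ofFinite _
  have h := (Finset.sum_eq_sum_iff_of_le (s := Finset.univ) (f := fun _ => 2)
    (g := fun C : G.ConnectedComponent =>
      (Finset.univ.filter fun i => G.connectedComponentMk i = C).card)
    fun C _ => card_fiber_ge_two hG C).1 (by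
      rw [← card_eq_sum_fiber, ← hcard, Nat.card_eq_fintype_card]; simp [mul_comm])
  exact (h C (Finset.mem_univ C)).symm

/-- Offsets in pairing codes are at most `2`, and being consecutive compares an offset with a
successor, so residues up to `3` must be distinct. -/
lemma nsmul_one_inj {n : ℕ} [NeZero n] (hn : 4 ≤ n) {a b : ℕ} (ha : a < 4) (hb : b < 4) :
    a • (1 : Fin n) = b • (1 : Fin n) ↔ a = b := by
  have hord : addOrderOf (1 : Fin n) = n := by
    obtain ⟨m, rfl⟩ : ∃ m, n = m + 1 := ⟨n - 1, by omega⟩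
    exact ZMod.addOrderOf_one (m + 1)
  rw [nsmul_eq_nsmul_iff_modEq, hord]
  constructor
  · intro h
    exact h.eq_of_lt_of_lt (by omega) (by omega)
  · rintro rfl
    rfl

/-- A description of a pattern whose graph is a perfect matching: a set that contains one index of
each pair, the map to the partners, and the offsets. -/
abbrev PairingCode (ι : Type*) [Fintype ι] : Type _ :=
  (Σ S : {S : Finset ι // 2 * S.card = Fintype.card ι}, {i // i ∉ S.1} ↪ {i // i ∈ S.1}) ×
    (ι → Fin 3)

open Classical in
/-- The chosen index in the pair of `i`. -/
noncomputable def PairingCode.rep (c : PairingCode ι) (i : ι) : {i // i ∈ c.1.1.1} :=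
  if h : i ∈ c.1.1.1 then ⟨i, h⟩ else c.1.2 ⟨i, h⟩

open Classical in
/-- The pattern with a given description. -/
noncomputable def PairingCode.pattern (c : PairingCode ι) : ι → ι → Bool × Bool :=
  fun i j => (decide (c.rep i = c.rep j ∧ c.2 i = c.2 j),
    decide (c.rep i = c.rep j ∧ (c.2 i : ℕ) = c.2 j + 1))

/-- There are at most `2 ^ u` sets, `(u / 2)!` matchings for each and `3 ^ u` offset vectors.
Squaring gives `36 = (2 * 3) ^ 2`, and `(u / 2)! ^ 2 ≤ u!`. The square is needed because a moment
involves a pair of patterns. -/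
lemma card_pairingCode_sq_le :
    Nat.card (PairingCode ι) ^ 2 ≤ 36 ^ Fintype.card ι * (Fintype.card ι).factorial := by
  classical
  set u := Fintype.card ι with hu
  have h1 : ∀ S : {S : Finset ι // 2 * S.card = Fintype.card ι},
      Fintype.card ({i // i ∉ S.1} ↪ {i // i ∈ S.1}) = (u / 2).factorial := by
    intro S
    have hS := S.2
    rw [Fintype.card_embedding_eq, Fintype.card_subtype_compl, Fintype.card_coe]
    have e1 : S.1.card = u / 2 := by omega
    have e2 : Fintype.card ι - S.1.card = u / 2 := by omega
    rw [e2, e1, Nat.descFactorial_self]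
  have h2 : Fintype.card {S : Finset ι // 2 * S.card = Fintype.card ι} ≤ 2 ^ u := by
    rw [← Fintype.card_finset]
    exact Fintype.card_subtype_le _
  have h3 : Nat.card (PairingCode ι) ≤ 2 ^ u * (u / 2).factorial * 3 ^ u := by
    rw [Nat.card_eq_fintype_card, Fintype.card_prod, Fintype.card_sigma, Fintype.card_fun, Fintype.card_fin]
    simp_rw [h1]
    rw [Finset.sum_const, Finset.card_univ, smul_eq_mul]
    gcongr
  have h4 : (u / 2).factorial ^ 2 ≤ u.factorial := by
    rw [sq]
    exact (Nat.le_of_dvd (Nat.factorial_pos _) (Nat.factorial_mul_factorial_dvd_factorial_add _ _)).trans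
      (Nat.factorial_le (by omega))
  calc _ ≤ (2 ^ u * (u / 2).factorial * 3 ^ u) ^ 2 := by gcongr
    _ = 36 ^ u * (u / 2).factorial ^ 2 := by
      rw [show (36 : ℕ) = 2 ^ 2 * 3 ^ 2 by norm_num, mul_pow (2 ^ 2), ← pow_mul, ← pow_mul]
      ring
    _ ≤ _ := by gcongr

lemma exists_pairingCode {n : ℕ} [NeZero n] (hn : 4 ≤ n) {k : ι → Fin n}
    (hG : ∀ i, ∃ j, (patternGraph (adjacencyPattern k)).Adj i j)
    (hcard : 2 * Nat.card (patternGraph (adjacencyPattern k)).ConnectedComponent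
      = Fintype.card ι) :
    ∃ c : PairingCode ι, adjacencyPattern k = c.pattern := by
  classical
  set G := patternGraph (adjacencyPattern k) with hGdef
  let r : ι → ι := fun i => (G.connectedComponentMk i).out
  have hmk : ∀ i, G.connectedComponentMk (r i) = G.connectedComponentMk i := fun i =>
    Quot.out_eq (G.connectedComponentMk i)
  have hr : ∀ {i j}, G.connectedComponentMk i = G.connectedComponentMk j → r i = r j :=
    fun h => congrArg Quot.out h
  have hr' : ∀ {i j}, r i = r j → G.connectedComponentMk i = G.connectedComponentMk j :=
    fun {i j} h => by rw [← hmk i, h, hmk j]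
  -- Equality in the component count forces every component to have exactly two elements.
  have hthree : ∀ {i j l : ι}, r i = r l → r j = r l → i ≠ l → j ≠ l → i = j := by
    intro i j l hi hj hil hjl
    by_contra hij
    have h3 : ({i, j, l} : Finset ι) ⊆ Finset.univ.filter fun x =>
        G.connectedComponentMk x = G.connectedComponentMk l := by
      intro x hx
      simp only [Finset.mem_insert, Finset.mem_singleton] at hx
      rcases hx with rfl | rfl | rfl
      · simpa using hr' hi
      · simpa using hr' hj
      · simp
    have := Finset.card_le_card h3
    rw [card_fiber_eq_two hG hcard, Finset.card_eq_three.2 ⟨i, j, l, hij, hil, hjl, rfl⟩] at this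
    omega
  have hrr : ∀ i, r (r i) = r i := fun i => hr (hmk i)
  -- An entry differs from that of its representative by `-1`, `0` or `1`. The shift by one makes
  -- this a natural number, so a representative has offset `1`.
  have hoff : ∀ i, ∃ o : Fin 3, k i + 1 = k (r i) + (o : ℕ) • 1 := by
    intro i
    by_cases hi : i = r i
    · exact ⟨1, by rw [← hi]; simp⟩
    · obtain ⟨j, hj⟩ := hG i
      have hij : r j = r i := hr (SimpleGraph.ConnectedComponent.sound hj.reachable.symm)
      have : j = r i := hthree (l := i) hij (hrr i) hj.ne' (Ne.symm hi)
      subst this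
      obtain ⟨-, h | h | h⟩ := patternGraph_adj_adjacencyPattern.1 hj
      · exact ⟨1, by rw [h]; simp⟩
      · refine ⟨2, by rw [h, add_assoc]; simp [two_nsmul]⟩
      · exact ⟨0, by rw [h]; simp⟩
  choose o ho using hoff
  let S : Finset ι := Finset.univ.image fun C : G.ConnectedComponent => Quot.out C
  have hS : S.card = Nat.card G.ConnectedComponent := by
    have hinj : Function.Injective fun C : G.ConnectedComponent => Quot.out C :=
      Function.LeftInverse.injective Quot.out_eq
    rw [Finset.card_image_of_injective _ hinj, Nat.card_eq_fintype_card,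
      Finset.card_univ]
  have hrS : ∀ i, r i ∈ S := fun i =>
    Finset.mem_image.2 ⟨G.connectedComponentMk i, Finset.mem_univ _, rfl⟩
  have hSr : ∀ i ∈ S, r i = i := by
    intro i hi
    obtain ⟨C, -, rfl⟩ := Finset.mem_image.1 hi
    exact congrArg Quot.out (Quot.out_eq C)
  let e : {i // i ∉ S} ↪ {i // i ∈ S} := ⟨fun i => ⟨r i, hrS i⟩, by
    rintro ⟨i, hi⟩ ⟨j, hj⟩ h
    have h' : r i = r j := congrArg Subtype.val h
    refine Subtype.ext (hthree (l := r i) (hrr i).symm ?_ ?_ ?_)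
    · rw [hrr, h']
    · exact fun h => hi ((show i = r i from h) ▸ hrS i)
    · exact fun h => hj ((show j = r i from h) ▸ hrS i)⟩
  let c : PairingCode ι := ⟨⟨⟨S, by rw [hS, hcard]⟩, e⟩, o⟩
  have hrep : ∀ i, c.rep i = ⟨r i, hrS i⟩ := by
    intro i
    unfold PairingCode.rep
    split_ifs with h
    · exact Subtype.ext (hSr i h).symm
    · rfl
  refine ⟨c, ?_⟩
  funext i j
  have hadj : ∀ i j, r i ≠ r j → k i ≠ k j ∧ k i ≠ k j + 1 := by
    intro i j hij
    have : ¬ G.Adj i j := fun h =>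
      hij (hr (SimpleGraph.ConnectedComponent.sound h.reachable))
    rw [hGdef, patternGraph_adj_adjacencyPattern] at this
    have hne : i ≠ j := fun h => hij (h ▸ rfl)
    tauto
  simp only [PairingCode.pattern, adjacencyPattern, hrep, Subtype.mk.injEq, c]
  by_cases hij : r i = r j
  · have h1 := ho i
    have h2 := ho j
    rw [← hij] at h2
    have e1 : k i = k j ↔ o i = o j := by
      rw [← add_left_inj (1 : Fin n), h1, h2, add_right_inj, nsmul_one_inj hn (by omega) (by omega),
        Fin.ext_iff]
    have e2 : k i = k j + 1 ↔ (o i : ℕ) = o j + 1 := by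
      rw [← add_left_inj (1 : Fin n), h1, h2, add_assoc, add_right_inj, ← succ_nsmul,
        nsmul_one_inj hn (by omega) (by omega)]
    simp [hij, e1, e2]
  · have := hadj i j hij
    simp [hij, this.1, this.2]

lemma card_function_eq_add_le {κ : Type*} [Fintype κ] [DecidableEq κ] {n : ℕ} [NeZero n] {a b : κ}
    (hab : a ≠ b) (s t : Fin n) :
    (Finset.univ.filter fun w : κ → Fin n => w a + s = w b + t).card
      ≤ n ^ (Fintype.card κ - 1) := by
  have : n ^ (Fintype.card κ - 1) = Fintype.card ({x // x ≠ a} → Fin n) := by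
    simp [Fintype.card_subtype_compl]
  rw [this, ← Finset.card_univ]
  refine Finset.card_le_card_of_injOn (fun w x => w x) (fun _ _ => by simp) ?_
  intro w hw w' hw' h
  simp only [Finset.coe_filter, Finset.mem_univ, true_and, Set.mem_ofPred_eq] at hw hw'
  have hne : ∀ x, x ≠ a → w x = w' x := fun x hx => congrFun h ⟨x, hx⟩
  ext1 x
  by_cases hx : x = a
  · subst hx
    rw [← add_left_inj s, hw, hw', hne b hab.symm]
  · exact hne x hx

/-- Values at the representatives can be chosen freely, and the offsets give the rest. The result
has the right pattern unless entries from different pairs are equal or consecutive. Each such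
coincidence costs one degree of freedom, and there are at most two for each of the `card ι ^ 2`
pairs of indices. -/
lemma pow_le_patternCount {n : ℕ} (hn : 4 ≤ n + 1) (c : PairingCode ι) :
    (n + 1) ^ c.1.1.1.card ≤ patternCount n c.pattern +
      2 * Fintype.card ι ^ 2 * (n + 1) ^ (c.1.1.1.card - 1) := by
  classical
  let κ := {i // i ∈ c.1.1.1}
  have hκ : Fintype.card κ = c.1.1.1.card := Fintype.card_coe _
  let K : (κ → Fin (n + 1)) → ι → Fin (n + 1) := fun w i => w (c.rep i) + (c.2 i : ℕ) • 1
  let bad : ι × ι → Finset (κ → Fin (n + 1)) := fun p =>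
    if c.rep p.1 = c.rep p.2 then ∅ else
      Finset.univ.filter (fun w => K w p.1 = K w p.2) ∪
        Finset.univ.filter (fun w => K w p.1 = K w p.2 + 1)
  have hbad : ∀ p, (bad p).card ≤ 2 * (n + 1) ^ (c.1.1.1.card - 1) := by
    intro p
    by_cases hp : c.rep p.1 = c.rep p.2
    · simp [bad, hp]
    · simp only [bad, hp, if_false]
      refine (Finset.card_union_le _ _).trans ?_
      rw [two_mul, ← hκ]
      gcongr
      · exact card_function_eq_add_le hp _ _
      · simp only [K, add_assoc]
        exact card_function_eq_add_le hp _ _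
  have hgood : (Finset.univ \ Finset.univ.biUnion bad).card ≤ patternCount n c.pattern := by
    rw [patternCount]
    refine Finset.card_le_card_of_injOn K ?_ ?_
    · intro w hw
      simp only [Finset.coe_sdiff, Finset.coe_univ, Set.mem_sdiff, Set.mem_univ, true_and,
        Finset.mem_coe, Finset.mem_biUnion, Finset.mem_univ, not_exists] at hw
      simp only [Finset.coe_filter, Finset.mem_univ, true_and, Set.mem_ofPred_eq]
      funext i j
      by_cases hij : c.rep i = c.rep j
      · have e1 : K w i = K w j ↔ c.2 i = c.2 j := by
          simp only [K]
          rw [hij, add_right_inj, nsmul_one_inj hn (by omega) (by omega), Fin.ext_iff]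
        have e2 : K w i = K w j + 1 ↔ (c.2 i : ℕ) = c.2 j + 1 := by
          simp only [K]
          rw [hij, add_assoc, add_right_inj, ← succ_nsmul,
            nsmul_one_inj hn (by omega) (by omega)]
        simp [adjacencyPattern, PairingCode.pattern, hij, e1, e2]
      · have := hw (i, j)
        simp only [bad, hij, if_false, Finset.mem_union, Finset.mem_filter, Finset.mem_univ,
          true_and, not_or] at this
        simp [adjacencyPattern, PairingCode.pattern, hij, this.1, this.2]
    · intro w _ w' _ h
      ext1 x
      have hx : c.rep x.1 = x := by
        unfold PairingCode.rep
        rw [dif_pos x.2]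
      have := congrFun h x.1
      simp only [K, hx] at this
      exact add_right_cancel this
  have hcard : (Finset.univ.biUnion bad).card
      ≤ 2 * Fintype.card ι ^ 2 * (n + 1) ^ (c.1.1.1.card - 1) := by
    calc _ ≤ ∑ p, (bad p).card := Finset.card_biUnion_le
      _ ≤ ∑ _p : ι × ι, 2 * (n + 1) ^ (c.1.1.1.card - 1) := Finset.sum_le_sum fun p _ => hbad p
      _ = _ := by
        rw [Finset.sum_const, Finset.card_univ, Fintype.card_prod, smul_eq_mul]; ring
  calc (n + 1) ^ c.1.1.1.card = Fintype.card (κ → Fin (n + 1)) := by simp [← hκ]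
    _ ≤ (Finset.univ \ Finset.univ.biUnion bad).card + (Finset.univ.biUnion bad).card := by
      rw [← Finset.card_univ]
      exact (Finset.card_le_card (by simp)).trans (Finset.card_union_le _ _)
    _ ≤ _ := add_le_add hgood hcard

/-! ### Convergence of the moments -/

/-- The patterns that contribute to the leading order: those without isolated indices which have a
perfect matching as their graph. -/
def IsPairingPattern (D : ι → ι → Bool × Bool) : Prop :=
  (∀ i, ∃ j, (patternGraph D).Adj i j) ∧
    2 * Nat.card (patternGraph D).ConnectedComponent = Fintype.card ι ∧
    ∃ n, 4 ≤ n + 1 ∧ ∃ k : ι → Fin (n + 1), adjacencyPattern k = D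

lemma card_isPairingPattern_le :
    Nat.card {D : ι → ι → Bool × Bool // IsPairingPattern D} ≤ Nat.card (PairingCode ι) := by
  classical
  have h : ∀ D : {D : ι → ι → Bool × Bool // IsPairingPattern D},
      ∃ c : PairingCode ι, D.1 = c.pattern := by
    rintro ⟨D, hG, hcard, n, hn, k, rfl⟩
    exact exists_pairingCode hn hG hcard
  choose f hf using h
  exact Nat.card_le_card_of_injective f fun D D' hD => Subtype.ext (by rw [hf, hf, hD])

-- With fewer than `card ι / 2` components the upper bound is of smaller order; with equality the
-- count is squeezed between two bounds with the same leading term. The square root lets one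
-- normalisation serve odd `card ι` too.
open Classical in
lemma tendsto_patternCount {D : ι → ι → Bool × Bool}
    (hD : ∀ i, ∃ j, (patternGraph D).Adj i j) :
    Tendsto (fun n : ℕ => (patternCount n D : ℝ) / √((n : ℝ) + 1) ^ Fintype.card ι) atTop
      (𝓝 (if IsPairingPattern D then 1 else 0)) := by
  set c := Nat.card (patternGraph D).ConnectedComponent with hc
  have hle : ∀ n, (patternCount n D : ℝ) ≤ ((n : ℝ) + 1) ^ c := fun n => by
    exact_mod_cast patternCount_le_pow n D
  have hsq : ∀ n : ℕ, √((n : ℝ) + 1) ^ 2 = (n : ℝ) + 1 := fun n => Real.sq_sqrt (by positivity)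
  have hs1 : ∀ n : ℕ, 1 ≤ √((n : ℝ) + 1) := fun n => by
    rw [Real.one_le_sqrt]; linarith [Nat.cast_nonneg (α := ℝ) n]
  have hinf : Tendsto (fun n : ℕ => (n : ℝ) + 1) atTop atTop :=
    tendsto_atTop_add_const_right _ _ tendsto_natCast_atTop_atTop
  rcases (two_mul_card_connectedComponent_le hD).lt_or_eq with hlt | heq
  · have hnot : ¬ IsPairingPattern D := fun h => hlt.ne h.2.1
    rw [if_neg hnot]
    have hlim : Tendsto (fun n : ℕ => (√((n : ℝ) + 1))⁻¹) atTop (𝓝 0) :=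
      tendsto_inv_atTop_zero.comp (Real.tendsto_sqrt_atTop.comp hinf)
    refine tendsto_of_tendsto_of_tendsto_of_le_of_le tendsto_const_nhds hlim
      (fun n => by positivity) fun n => ?_
    have hpos : 0 < √((n : ℝ) + 1) := by linarith [hs1 n]
    simp only
    rw [div_le_iff₀ (by positivity)]
    calc (patternCount n D : ℝ) ≤ ((n : ℝ) + 1) ^ c := hle n
      _ = (√((n : ℝ) + 1))⁻¹ * √((n : ℝ) + 1) ^ (2 * c + 1) := by
        rw [pow_succ, pow_mul, hsq]
        field_simp
      _ ≤ _ := by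
        gcongr
        · exact hs1 n
        · omega
  · have hpow : ∀ n : ℕ, √((n : ℝ) + 1) ^ Fintype.card ι = ((n : ℝ) + 1) ^ c := fun n => by
      rw [← heq, pow_mul, hsq]
    simp_rw [hpow]
    split_ifs with hP
    · obtain ⟨-, -, n₀, hn₀, k, hk⟩ := hP
      obtain ⟨code, hcode⟩ := exists_pairingCode hn₀ (k := k) (by rwa [hk]) (by rwa [hk])
      rw [hk] at hcode
      have hS : code.1.1.1.card = c := by
        have := code.1.1.2
        omega
      have hlow : ∀ᶠ n : ℕ in atTop, 1 - 2 * (Fintype.card ι : ℝ) ^ 2 / ((n : ℝ) + 1)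
          ≤ (patternCount n D : ℝ) / ((n : ℝ) + 1) ^ c := by
        filter_upwards [eventually_ge_atTop 3] with n hn
        have h := pow_le_patternCount (by omega : 4 ≤ n + 1) code
        rw [hS, ← hcode] at h
        have h' : ((n : ℝ) + 1) ^ c ≤ patternCount n D +
            2 * (Fintype.card ι : ℝ) ^ 2 * ((n : ℝ) + 1) ^ (c - 1) := by exact_mod_cast h
        have hpos : (0 : ℝ) < (n : ℝ) + 1 := by positivity
        rw [le_div_iff₀ (by positivity), sub_mul, one_mul, sub_le_iff_le_add]
        refine h'.trans (add_le_add le_rfl ?_)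
        -- For `c = 0` the exponent `c - 1` is truncated to `0`, but the error term vanishes because
        -- `ι` is empty.
        rcases Nat.eq_zero_or_pos c with h0 | h0
        · have : Fintype.card ι = 0 := by omega
          simp [this]
        · obtain ⟨b, hb⟩ : ∃ b, c = b + 1 := ⟨c - 1, by omega⟩
          rw [hb, Nat.add_sub_cancel, pow_succ]
          apply le_of_eq
          field_simp
          ring
      have hlim : Tendsto (fun n : ℕ => 1 - 2 * (Fintype.card ι : ℝ) ^ 2 / ((n : ℝ) + 1)) atTop
          (𝓝 1) := by
        simpa using (tendsto_const_nhds (x := (1 : ℝ))).sub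
          ((tendsto_const_nhds (x := 2 * (Fintype.card ι : ℝ) ^ 2)).div_atTop hinf)
      refine tendsto_of_tendsto_of_tendsto_of_le_of_le' hlim tendsto_const_nhds hlow
        (Eventually.of_forall fun n => ?_)
      exact div_le_one_of_le₀ (hle n) (by positivity)
    -- The only condition that can fail here is realisability on a cycle of length at least `4`, so
    -- the count is eventually zero.
    · refine tendsto_const_nhds.congr' ?_
      filter_upwards [eventually_ge_atTop 3] with n hn
      have : patternCount n D = 0 := by
        rw [patternCount, Finset.card_eq_zero, Finset.filter_eq_empty_iff]
        intro k _ hk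
        exact hP ⟨hD, heq, n, by omega, k, hk⟩
      simp [this]

open Classical in
/-- The contribution of a pair of index vectors with given patterns to a moment of the linking
number. -/
noncomputable def patternWeight (D D' : ι → ι → Bool × Bool) : ℝ :=
  if h : ∃ (n : ℕ) (k l : ι → Fin (n + 1)), adjacencyPattern k = D ∧ adjacencyPattern l = D' then
    mixedMoment 0 1 h.choose_spec.choose h.choose_spec.choose_spec.choose *
      mixedMoment 1 0 h.choose_spec.choose_spec.choose fun i => h.choose_spec.choose i + 1
  else 0

/-- The vectors chosen in the definition do not matter, since both mixed moments depend only on the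
patterns and the shift `k i + 1` preserves equalities. -/
lemma patternWeight_adjacencyPattern {n : ℕ} (k l : ι → Fin (n + 1)) :
    patternWeight (adjacencyPattern k) (adjacencyPattern l) =
      mixedMoment 0 1 k l * mixedMoment 1 0 l fun i => k i + 1 := by
  have h : ∃ (n' : ℕ) (k' l' : ι → Fin (n' + 1)), adjacencyPattern k' = adjacencyPattern k ∧
    adjacencyPattern l' = adjacencyPattern l := ⟨n, k, l, rfl, rfl⟩
  rw [patternWeight, dif_pos h]
  obtain ⟨hk, hl⟩ := h.choose_spec.choose_spec.choose_spec
  have hk' := adjacencyPattern_eq_iff.1 hk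
  have hl' := adjacencyPattern_eq_iff.1 hl
  congr 1
  · exact mixedMoment_congr (by simp) hk fun i j => (hl' i j).1
  · exact mixedMoment_congr (by simp) hl fun i j => by simpa using (hk' i j).1

lemma patternWeight_abs_le (D D' : ι → ι → Bool × Bool) : |patternWeight D D'| ≤ 1 := by
  unfold patternWeight
  split_ifs
  · rw [abs_mul]
    exact mul_le_one₀ (mixedMoment_abs_le _ _ _ _) (abs_nonneg _) (mixedMoment_abs_le _ _ _ _)
  · simp

lemma mixedMoment_eq_zero_of_isolated {n : ℕ} [NeZero n] {c c' : Fin 2} (hc : c ≠ c')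
    {k l : ι → Fin n} {i : ι} (hi : ∀ j, ¬ (patternGraph (adjacencyPattern k)).Adj i j) :
    mixedMoment c c' k l = 0 := by
  refine mixedMoment_eq_zero hc (i := i) fun j hj => ?_
  have := hi j
  rw [patternGraph_adj_adjacencyPattern] at this
  have e : k j = k i ↔ k i = k j := eq_comm
  have hij := hj.symm
  tauto

lemma patternWeight_eq_zero {D D' : ι → ι → Bool × Bool}
    (h : ¬ ((∀ i, ∃ j, (patternGraph D).Adj i j) ∧ ∀ i, ∃ j, (patternGraph D').Adj i j)) :
    patternWeight D D' = 0 := by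
  by_cases hex : ∃ (n : ℕ) (k l : ι → Fin (n + 1)), adjacencyPattern k = D ∧ adjacencyPattern l = D'
  · obtain ⟨n, k, l, rfl, rfl⟩ := hex
    rw [patternWeight_adjacencyPattern]
    rw [not_and_or] at h
    push Not at h
    rcases h with ⟨i, hi⟩ | ⟨i, hi⟩
    · rw [mixedMoment_eq_zero_of_isolated (by simp) hi, zero_mul]
    · rw [mixedMoment_eq_zero_of_isolated (by simp) hi, mul_zero]
  · rw [patternWeight, dif_neg hex]

lemma sum_patternWeight (n : ℕ) [DecidableEq ι] :
    ∑ k : ι → Fin (n + 1), ∑ l : ι → Fin (n + 1),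
      mixedMoment 0 1 k l * mixedMoment 1 0 l (fun i => k i + 1) =
    ∑ D : ι → ι → Bool × Bool, ∑ D' : ι → ι → Bool × Bool,
      patternWeight D D' * (patternCount n D * patternCount n D') := by
  classical
  have h : ∀ f : (ι → ι → Bool × Bool) → ℝ, ∑ k : ι → Fin (n + 1), f (adjacencyPattern k) =
      ∑ D : ι → ι → Bool × Bool, f D * patternCount n D := by
    intro f
    rw [← Finset.sum_fiberwise (g := fun k : ι → Fin (n + 1) => adjacencyPattern k)]
    refine Finset.sum_congr rfl fun D _ => ?_
    rw [Finset.sum_congr rfl (g := fun _ => f D) fun k hk => by rw [(Finset.mem_filter.1 hk).2],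
      Finset.sum_const, nsmul_eq_mul, mul_comm, patternCount]
    congr!
  simp_rw [← patternWeight_adjacencyPattern]
  have h' : ∀ D, ∑ l : ι → Fin (n + 1), patternWeight D (adjacencyPattern l) =
      ∑ D' : ι → ι → Bool × Bool, patternWeight D D' * patternCount n D' :=
    fun D => h (patternWeight D)
  simp_rw [h']
  rw [h fun D => ∑ D' : ι → ι → Bool × Bool, patternWeight D D' * patternCount n D']
  refine Finset.sum_congr rfl fun D _ => ?_
  rw [Finset.sum_mul]
  exact Finset.sum_congr rfl fun D' _ => by ring

open Classical in
/-- The limit of the moments of the normalized linking number. -/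
noncomputable def limitMoment (u : ℕ) : ℝ :=
  (-1) ^ u * ∑ D : Fin u → Fin u → Bool × Bool, ∑ D' : Fin u → Fin u → Bool × Bool,
    patternWeight D D' * ((if IsPairingPattern D then 1 else 0) *
      (if IsPairingPattern D' then 1 else 0))

theorem tendsto_normalizedLkMoment (u : ℕ) :
    Tendsto (fun n : ℕ => normalizedLkMoment n u) atTop (𝓝 (limitMoment u)) := by
  classical
  rw [← tendsto_add_atTop_iff_nat 1]
  have heq : ∀ n : ℕ, normalizedLkMoment (n + 1) u = (-1) ^ u *
      ∑ D : Fin u → Fin u → Bool × Bool, ∑ D' : Fin u → Fin u → Bool × Bool,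
        patternWeight D D' * ((patternCount n D : ℝ) / √((n : ℝ) + 1) ^ u *
          ((patternCount n D' : ℝ) / √((n : ℝ) + 1) ^ u)) := by
    intro n
    rw [normalizedLkMoment_eq, sum_patternWeight, mul_div_assoc, Finset.sum_div]
    congr 1
    refine Finset.sum_congr rfl fun D _ => ?_
    rw [Finset.sum_div]
    refine Finset.sum_congr rfl fun D' _ => ?_
    rw [div_mul_div_comm, ← mul_pow, Real.mul_self_sqrt (by positivity), mul_div_assoc]
    push_cast
    rfl
  simp_rw [heq, limitMoment]
  refine Tendsto.const_mul _ (tendsto_finsetSum _ fun D _ => tendsto_finsetSum _ fun D' _ => ?_)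
  -- The counts of patterns with isolated indices may outgrow the normalisation, but their weight is
  -- exactly zero.
  by_cases h : (∀ i, ∃ j, (patternGraph D).Adj i j) ∧ ∀ i, ∃ j, (patternGraph D').Adj i j
  · have h1 := tendsto_patternCount h.1
    have h2 := tendsto_patternCount h.2
    rw [Fintype.card_fin] at h1 h2
    exact (h1.mul h2).const_mul _
  · simp [patternWeight_eq_zero h]

/-- All weights are at most `1` in absolute value, so the square of the number of pairing patterns
is a bound. -/
lemma limitMoment_abs_le (u : ℕ) : |limitMoment u| ≤ 36 ^ u * u.factorial := by
  classical
  have hcount : ∑ D : Fin u → Fin u → Bool × Bool, (if IsPairingPattern D then (1 : ℝ) else 0) =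
      Nat.card {D : Fin u → Fin u → Bool × Bool // IsPairingPattern D} := by
    rw [Finset.sum_boole, Nat.card_eq_fintype_card, Fintype.card_subtype]
  have hsq : ((Nat.card {D : Fin u → Fin u → Bool × Bool // IsPairingPattern D} : ℕ) : ℝ) ^ 2
      ≤ 36 ^ u * u.factorial := by
    have h1 := card_isPairingPattern_le (ι := Fin u)
    have h2 := card_pairingCode_sq_le (ι := Fin u)
    rw [Fintype.card_fin] at h2
    exact_mod_cast (Nat.pow_le_pow_left h1 2).trans h2
  rw [limitMoment, abs_mul, abs_pow, abs_neg, abs_one, one_pow, one_mul]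
  refine le_trans ?_ hsq
  rw [← hcount, sq, Finset.sum_mul_sum]
  refine (Finset.abs_sum_le_sum_abs _ _).trans (Finset.sum_le_sum fun D _ => ?_)
  refine (Finset.abs_sum_le_sum_abs _ _).trans (Finset.sum_le_sum fun D' _ => ?_)
  rw [abs_mul]
  refine (mul_le_of_le_one_left (abs_nonneg _) (patternWeight_abs_le _ _)).trans_eq ?_
  rw [abs_of_nonneg]
  split_ifs <;> simp

/-! ### The second moment -/

/-- The indicator of the event that the value of `σ` at `p` is less than the one at `q`. -/
def ltIndicator {N : ℕ} (σ : Equiv.Perm (Fin N)) (p q : Fin N) : ℝ :=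
  if σ p < σ q then 1 else 0

section ltIndicator

variable {N : ℕ} {p q r s : Fin N}

lemma ltIndicator_add_swap (σ : Equiv.Perm (Fin N)) (hpq : p ≠ q) :
    ltIndicator σ p q + ltIndicator σ q p = 1 := by
  have : σ p ≠ σ q := σ.injective.ne hpq
  rcases lt_or_gt_of_ne this with h | h <;> simp [ltIndicator, h, h.not_gt]

lemma expect_comp_swap (f : Equiv.Perm (Fin N) → ℝ) (p q : Fin N) :
    𝔼 σ, f (σ * Equiv.swap p q) = 𝔼 σ, f σ :=
  Fintype.expect_equiv (Equiv.mulRight (Equiv.swap p q)) _ _ fun _ => rfl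

lemma expect_ltIndicator (hpq : p ≠ q) :
    𝔼 σ : Equiv.Perm (Fin N), ltIndicator σ p q = 1 / 2 := by
  have h1 := expect_comp_swap (fun σ => ltIndicator σ p q) p q
  simp only [ltIndicator, Equiv.Perm.mul_apply, Equiv.swap_apply_left,
    Equiv.swap_apply_right] at h1
  have h2 : 𝔼 σ : Equiv.Perm (Fin N), (ltIndicator σ p q + ltIndicator σ q p) = 1 := by
    simp_rw [ltIndicator_add_swap _ hpq]
    exact Fintype.expect_const _
  rw [Finset.expect_add_distrib] at h2
  simp only [ltIndicator] at h2 ⊢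
  linarith

lemma expect_ltIndicator_mul_of_disjoint (hpq : p ≠ q) (hrs : r ≠ s) (hpr : p ≠ r) (hps : p ≠ s)
    (hqr : q ≠ r) (hqs : q ≠ s) :
    𝔼 σ : Equiv.Perm (Fin N), ltIndicator σ p q * ltIndicator σ r s = 1 / 4 := by
  have h1 := expect_comp_swap (fun σ => ltIndicator σ p q * ltIndicator σ r s) p q
  simp only [ltIndicator, Equiv.Perm.mul_apply, Equiv.swap_apply_left, Equiv.swap_apply_right,
    Equiv.swap_apply_of_ne_of_ne hpr.symm hqr.symm,
    Equiv.swap_apply_of_ne_of_ne hps.symm hqs.symm] at h1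
  have h2 : 𝔼 σ : Equiv.Perm (Fin N), (ltIndicator σ p q * ltIndicator σ r s +
      ltIndicator σ q p * ltIndicator σ r s) = 1 / 2 := by
    simp_rw [← add_mul, ltIndicator_add_swap _ hpq, one_mul]
    exact expect_ltIndicator hrs
  rw [Finset.expect_add_distrib] at h2
  simp only [ltIndicator] at h2 ⊢
  linarith

/-- The product indicates that the value at `r` is the largest of three, and by the swaps each of
the three is equally likely to be. -/
lemma expect_ltIndicator_mul_of_right (hpq : p ≠ q) (hpr : p ≠ r) (hqr : q ≠ r) :
    𝔼 σ : Equiv.Perm (Fin N), ltIndicator σ p r * ltIndicator σ q r = 1 / 3 := by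
  have h1 := expect_comp_swap (fun σ => ltIndicator σ p r * ltIndicator σ q r) p r
  have h2 := expect_comp_swap (fun σ => ltIndicator σ p r * ltIndicator σ q r) q r
  simp only [ltIndicator, Equiv.Perm.mul_apply, Equiv.swap_apply_left, Equiv.swap_apply_right,
    Equiv.swap_apply_of_ne_of_ne hpq.symm hqr, Equiv.swap_apply_of_ne_of_ne hpq hpr] at h1 h2
  have h3 : 𝔼 σ : Equiv.Perm (Fin N), (ltIndicator σ p r * ltIndicator σ q r +
      ltIndicator σ r p * ltIndicator σ q p + ltIndicator σ p q * ltIndicator σ r q) = 1 := by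
    refine (Finset.expect_congr rfl fun σ _ => ?_).trans (Fintype.expect_const (1 : ℝ))
    have e1 : σ p ≠ σ q := σ.injective.ne hpq
    have e2 : σ p ≠ σ r := σ.injective.ne hpr
    have e3 : σ q ≠ σ r := σ.injective.ne hqr
    unfold ltIndicator
    split_ifs <;> first | (exfalso; omega) | norm_num
  rw [Finset.expect_add_distrib, Finset.expect_add_distrib] at h3
  simp only [ltIndicator] at h3 ⊢
  linarith

lemma expect_ltIndicator_mul_of_left (hpq : p ≠ q) (hpr : p ≠ r) (hqr : q ≠ r) :
    𝔼 σ : Equiv.Perm (Fin N), ltIndicator σ r p * ltIndicator σ r q = 1 / 3 := by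
  have h : ∀ σ : Equiv.Perm (Fin N), ltIndicator σ r p * ltIndicator σ r q =
      1 - ltIndicator σ p r - ltIndicator σ q r + ltIndicator σ p r * ltIndicator σ q r := by
    intro σ
    have h1 := ltIndicator_add_swap σ hpr
    have h2 := ltIndicator_add_swap σ hqr
    rw [eq_sub_of_add_eq' h1, eq_sub_of_add_eq' h2]
    ring
  simp_rw [h]
  rw [Finset.expect_add_distrib, Finset.expect_sub_distrib, Finset.expect_sub_distrib,
    Fintype.expect_const, expect_ltIndicator hpr, expect_ltIndicator hqr,
    expect_ltIndicator_mul_of_right hpq hpr hqr]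
  norm_num

/-- The four values `1/4`, `1/3`, `1/3`, `1/2` are arranged so that the differences in `k` and `k'`
taken in `mixedMoment_two` kill all but the last term. -/
lemma expect_ltIndicator_position {n : ℕ} {c c' : Fin 2} (hc : c ≠ c') (k k' l l' : Fin n) :
    𝔼 σ : Equiv.Perm (Fin (2 * n)), ltIndicator σ (position c k) (position c' l) *
      ltIndicator σ (position c k') (position c' l') =
    1 / 4 + (1 / 12) * (if l = l' then 1 else 0) +
      (1 / 12) * (1 + if l = l' then 1 else 0) * (if k = k' then 1 else 0) := by
  have hne : ∀ x y : Fin n, position c x ≠ position c' y := fun x y h => hc (position_inj.1 h).1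
  by_cases hk : k = k' <;> by_cases hl : l = l'
  · subst hk hl
    have : ∀ σ : Equiv.Perm (Fin (2 * n)), ltIndicator σ (position c k) (position c' l) *
        ltIndicator σ (position c k) (position c' l) =
          ltIndicator σ (position c k) (position c' l) := by
      intro σ
      unfold ltIndicator
      split_ifs <;> simp
    simp_rw [this]
    rw [expect_ltIndicator (hne k l)]
    norm_num
  · subst hk
    have hl' : position c' l ≠ position c' l' := by simpa [position_inj] using hl
    rw [expect_ltIndicator_mul_of_left hl' (hne k l).symm (hne k l').symm]
    norm_num [hl]
  · subst hl
    have hk' : position c k ≠ position c k' := by simpa [position_inj] using hk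
    rw [expect_ltIndicator_mul_of_right hk' (hne k l) (hne k' l)]
    norm_num [hk]
  · have hl' : position c' l ≠ position c' l' := by simpa [position_inj] using hl
    have hk' : position c k ≠ position c k' := by simpa [position_inj] using hk
    rw [expect_ltIndicator_mul_of_disjoint (hne k l) (hne k' l') hk' (hne k l') (hne k' l).symm hl']
    norm_num [hk, hl]

end ltIndicator

/-- The second difference of the Kronecker delta on the cyclic group. -/
def deltaLaplacian {n : ℕ} [NeZero n] (k k' : Fin n) : ℝ :=
  2 * (if k = k' then 1 else 0) - (if k = k' + 1 then 1 else 0) - (if k + 1 = k' then 1 else 0)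

lemma mixedMoment_two {n : ℕ} [NeZero n] {c c' : Fin 2} (hc : c ≠ c') (k l : Fin 2 → Fin n) :
    mixedMoment c c' k l =
      1 / 12 * ((1 + if l 0 = l 1 then 1 else 0) * deltaLaplacian (k 0) (k 1)) := by
  have h : ∀ σ : Equiv.Perm (Fin (2 * n)), ∏ i, halfCrossing σ c c' (k i) (l i) =
      ltIndicator σ (position c (k 0)) (position c' (l 0)) *
        ltIndicator σ (position c (k 1)) (position c' (l 1)) -
      ltIndicator σ (position c (k 0)) (position c' (l 0)) *
        ltIndicator σ (position c (k 1 + 1)) (position c' (l 1)) -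
      ltIndicator σ (position c (k 0 + 1)) (position c' (l 0)) *
        ltIndicator σ (position c (k 1)) (position c' (l 1)) +
      ltIndicator σ (position c (k 0 + 1)) (position c' (l 0)) *
        ltIndicator σ (position c (k 1 + 1)) (position c' (l 1)) := by
    intro σ
    rw [Fin.prod_univ_two]
    simp only [halfCrossing, ltIndicator]
    ring
  rw [mixedMoment]
  simp_rw [h]
  rw [Finset.expect_add_distrib, Finset.expect_sub_distrib, Finset.expect_sub_distrib,
    expect_ltIndicator_position hc, expect_ltIndicator_position hc,
    expect_ltIndicator_position hc, expect_ltIndicator_position hc, deltaLaplacian]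
  simp only [add_left_inj]
  ring

/-- Each row of the Laplacian sums to zero, so only the diagonal entries count. They equal `2`
because `1 ≠ 0` in `Fin n` once `n ≥ 2`. -/
lemma sum_deltaLaplacian {n : ℕ} [NeZero n] (hn : 2 ≤ n) :
    ∑ k : Fin n, ∑ k' : Fin n, (1 + if k = k' then 1 else 0) * deltaLaplacian k k' =
      2 * (n : ℝ) := by
  have hone : (1 : Fin n) ≠ 0 := by
    intro h
    have := congrArg Fin.val h
    rw [Fin.val_one', Fin.val_zero, Nat.mod_eq_of_lt (by omega)] at this
    exact one_ne_zero this
  have h : ∀ k : Fin n, ∑ k' : Fin n, (1 + if k = k' then 1 else 0) * deltaLaplacian k k' = 2 := by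
    intro k
    have h1 : ∀ k' : Fin n, (if k = k' + 1 then (1 : ℝ) else 0) = if k - 1 = k' then 1 else 0 := by
      intro k'
      simp only [sub_eq_iff_eq_add]
    simp only [add_mul, one_mul, Finset.sum_add_distrib, ite_mul, zero_mul, Finset.sum_ite_eq,
      Finset.mem_univ, if_true]
    simp only [deltaLaplacian, Finset.sum_sub_distrib, ← Finset.mul_sum, h1, Finset.sum_ite_eq,
      Finset.mem_univ, if_true]
    simp [hone]
    norm_num
  simp_rw [h]
  simp [mul_comm]

theorem normalizedLkMoment_two {n : ℕ} (hn : 2 ≤ n) : normalizedLkMoment n 2 = 1 / 36 := by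
  have : NeZero n := ⟨by omega⟩
  have hsum : ∑ k : Fin 2 → Fin n, ∑ l : Fin 2 → Fin n,
      mixedMoment 0 1 k l * mixedMoment 1 0 l (fun i => k i + 1) = (n : ℝ) ^ 2 / 36 := by
    -- Each mixed moment carries the Laplacian of one vector and the equality indicator of the
    -- other. Exchanging the indicators separates the two sums, giving `(2 * n) ^ 2 / 144`.
    have hfactor : ∀ k l : Fin 2 → Fin n,
        mixedMoment 0 1 k l * mixedMoment 1 0 l (fun i => k i + 1) =
        1 / 144 * (((1 + if k 0 = k 1 then 1 else 0) * deltaLaplacian (k 0) (k 1)) *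
          ((1 + if l 0 = l 1 then 1 else 0) * deltaLaplacian (l 0) (l 1))) := by
      intro k l
      rw [mixedMoment_two (by simp), mixedMoment_two (by simp)]
      simp only [add_left_inj]
      ring
    have htwo : ∑ k : Fin 2 → Fin n,
        (1 + if k 0 = k 1 then 1 else 0) * deltaLaplacian (k 0) (k 1) = 2 * (n : ℝ) := by
      rw [← sum_deltaLaplacian hn, ← Fintype.sum_prod_type']
      exact Fintype.sum_equiv (finTwoArrowEquiv (Fin n)) _ _ fun _ => rfl
    simp_rw [hfactor, ← Finset.mul_sum, ← Finset.sum_mul, htwo]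
    ring
  have hn0 : (n : ℝ) ≠ 0 := by exact_mod_cast this.out
  rw [normalizedLkMoment_eq, hsum]
  field_simp

/-! ### The limit theorem -/

/-- The distribution of the normalized linking number as a probability measure. -/
noncomputable def normalizedLkProbabilityMeasure (n : ℕ) : ProbabilityMeasure ℝ :=
  ⟨normalizedLkLaw n, inferInstance⟩

theorem exists_limit_normalizedLk : ∃ μ : ProbabilityMeasure ℝ,
    HasMoments (μ : Measure ℝ) limitMoment ∧
      Tendsto normalizedLkProbabilityMeasure atTop (𝓝 μ) :=
  exists_limit_of_tendsto_moments (by norm_num) limitMoment_abs_le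
    (fun n u => integrable_normalizedLkLaw n _ (by fun_prop))
    (fun u => tendsto_normalizedLkMoment u)

lemma convergesWeakly_normalizedLkLaw {μ : ProbabilityMeasure ℝ}
    (h : Tendsto normalizedLkProbabilityMeasure atTop (𝓝 μ)) :
    ConvergesWeakly normalizedLkLaw (μ : Measure ℝ) := by
  have h' : normalizedLkLaw = fun n => (normalizedLkProbabilityMeasure n : Measure ℝ) :=
    funext fun n => rfl
  rw [h']
  exact convergesWeakly_of_tendsto h

lemma limitMoment_two : limitMoment 2 = 1 / 36 := by
  refine tendsto_nhds_unique (tendsto_normalizedLkMoment 2) (tendsto_const_nhds.congr' ?_)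
  filter_upwards [eventually_ge_atTop 2] with n hn
  exact (normalizedLkMoment_two hn).symm

end GridModel

open GridModel in
theorem corollary1p2 :
    ∃ m : ℕ → ℝ,
      (∀ u : ℕ, Tendsto (fun n : ℕ => normalizedLkMoment n u) atTop (𝓝 (m u))) ∧
      m 2 = 1 / 36 ∧
      ∃ μ : Measure ℝ, IsProbabilityMeasure μ ∧ HasMoments μ m ∧
        (∀ ν : Measure ℝ, IsProbabilityMeasure ν → HasMoments ν m → ν = μ) ∧
        ConvergesWeakly normalizedLkLaw μ := by
  obtain ⟨μ, hμ, hlim⟩ := exists_limit_normalizedLk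
  exact ⟨limitMoment, tendsto_normalizedLkMoment, limitMoment_two, (μ : Measure ℝ), inferInstance,
    hμ, fun ν _ hν => eq_of_hasMoments (by norm_num) limitMoment_abs_le hν hμ,
    convergesWeakly_normalizedLkLaw hlim⟩
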